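/- Let $\mathcal H_{\mathbb R}$ be a real Hilbert space and, for each $N$, let $\{X_N(f)\}_{f\in\mathcal H_{\mathbb R}}$ be a family of $N\times N$ Hermitian Gaussian random matrices: the $X_N(f)=(x_{ij}(f))_{i,j=1}^N$ are (almost surely) Hermitian and the entries $\{x_{ij}(f): 1\le i,j\le N,\ f\in\mathcal H_{\mathbb R}\}$ form a centered jointly Gaussian family of complex random variables with $$\mathrm E\{x_{ij}(f)x_{kl}(g)\}=0\quad (i<j,\ k<l),\qquad \mathrm E\{x_{ij}(f)\overline{x_{kl}(g)}\}=\delta_{ik}\delta_{jl}\tfrac1N\langle f,g\rangle\quad(i\le j,\ k\le l).$$ Let $NC_2(n)$ be the set of non-crossing pairings of $\{1,\dots,n\}$ and put $\alpha(f_1,\dots,f_n)=\sum_{\pi\in NC_2(n)}\prod_{(i,j)\in\pi}\langle f_i,f_j\rangle$. Let $NC_2(n,m)$ be the set of annular non-crossing pairings, i.e. of those pairings $\pi$ of $\{1,\dots,n+m\}$ (regarded as involutions without fixed points) for which some block meets both $\{1,\dots,n\}$ and $\{n+1,\dots,n+m\}$ and $\gamma\pi$ has exactly $(n+m)/2$ cycles,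 where $\gamma=(1,\dots,n)(n+1,\dots,n+m)$. Consider the magnified fluctuations $$F_N(f_1,\dots,f_n)=\mathrm{Tr}[X_N(f_1)\cdots X_N(f_n)]-N\,\alpha(f_1,\dots,f_n).$$ Then, as $N\to\infty$, the family $(F_N(f_1,\dots,f_n))_{n\in\mathbb N,\,f_i\in\mathcal H_{\mathbb R}}$ converges in distribution (that is, all finite subfamilies converge jointly in distribution) to a family $(F(f_1,\dots,f_n))_{n\in\mathbb N,\,f_i\in\mathcal H_{\mathbb R}}$ of complex random variables on a common probability space which is a centered (jointly) Gaussian family with covariance $$\mathrm E\{F(f_1,\dots,f_n)\,F(f_{n+1},\dots,f_{n+m})\}=\sum_{\pi\in NC_2(n,m)}\ \prod_{(i,j)\in\pi}\langle f_i,f_j\rangle .$$ -/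

import Mathlib

open MeasureTheory ProbabilityTheory Filter
open scoped ComplexConjugate

universe u v

noncomputable section

namespace SecondOrder

/-- A pairing of `Fin k`, encoded as the involution without fixed points that exchanges the two
elements of every block. -/
def IsPairing {k : ℕ} (π : Equiv.Perm (Fin k)) : Prop :=
  ∀ i, π i ≠ i ∧ π (π i) = i

/-- The number of cycles of a permutation, fixed points included. -/
def numCycles {k : ℕ} (σ : Equiv.Perm (Fin k)) : ℕ :=
  Nat.card (Quotient (Equiv.Perm.SameCycle.setoid σ))

open Classical in
/-- The non-crossing pairings of `Fin n`: there are no two blocks `{i, π i}` and `{j, π j}`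
with `i < j < π i < π j`. -/
def NC2 (n : ℕ) : Finset (Equiv.Perm (Fin n)) :=
  {π | IsPairing π ∧ ∀ i j, ¬ (i < j ∧ j < π i ∧ π i < π j)}

/-- The permutation of `Fin (n + m)` with the two cycles `(0, ..., n - 1)` and
`(n, ..., n + m - 1)`. -/
def annularRotation (n m : ℕ) : Equiv.Perm (Fin (n + m)) :=
  finSumFinEquiv.permCongr (Equiv.sumCongr (finRotate n) (finRotate m))

open Classical in
/-- The annular non-crossing pairings: pairings `π` of `Fin (n + m)` that connect the two circles
`{0, ..., n - 1}` and `{n, ..., n + m - 1}` and are planar, that is, satisfy the geodesic condition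
that `γ π` has `(n + m) / 2` cycles, where `γ` is the rotation of the two circles. -/
def annularNC2 (n m : ℕ) : Finset (Equiv.Perm (Fin (n + m))) :=
  {π | IsPairing π ∧ (∃ (i : Fin n) (j : Fin m), π (Fin.castAdd m i) = Fin.natAdd n j) ∧
    2 * numCycles (annularRotation n m * π) = n + m}

section HilbertSpace

variable {H : Type*} [NormedAddCommGroup H] [InnerProductSpace ℝ H]

/-- The product of `⟨f i, f j⟩` over the blocks `{i, j}` of a pairing. -/
def pairingWeight {k : ℕ} (f : Fin k → H) (π : Equiv.Perm (Fin k)) : ℝ :=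
  ∏ i with i < π i, inner ℝ (f i) (f (π i))

/-- The limit `α(f_1, ..., f_n)` of the normalized trace. -/
def alpha {n : ℕ} (f : Fin n → H) : ℝ :=
  ∑ π ∈ NC2 n, pairingWeight f π

/-- The limit covariance: the sum over annular non-crossing pairings for the concatenation of the
two tuples `f` and `g`. -/
def limitCov {n m : ℕ} (f : Fin n → H) (g : Fin m → H) : ℝ :=
  ∑ π ∈ annularNC2 n m, pairingWeight (Fin.append f g) π

/-- A family `X f`, `f ∈ H`, of `N × N` Hermitian Gaussian random matrices: the matrices are
Hermitian, all their entries together form a centered (jointly) Gaussian family, and the covariance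
is as prescribed. -/
structure IsHermitianGaussianFamily {N : ℕ} {Ω : Type*} [MeasurableSpace Ω] (P : Measure Ω)
    (X : H → Ω → Matrix (Fin N) (Fin N) ℂ) : Prop where
  hermitian : ∀ f, ∀ᵐ ω ∂P, (X f ω).IsHermitian
  gaussian : IsGaussianProcess
    (fun (t : H × Fin N × Fin N) (ω : Ω) => X t.1 ω t.2.1 t.2.2) P
  centered : ∀ f i j, ∫ ω, X f ω i j ∂P = 0
  pseudoCov : ∀ f g i j k l, i < j → k < l → ∫ ω, X f ω i j * X g ω k l ∂P = 0
  cov : ∀ f g i j k l, i ≤ j → k ≤ l →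
    ∫ ω, X f ω i j * conj (X g ω k l) ∂P =
      if i = k ∧ j = l then (1 / (N : ℂ)) * ((inner ℝ f g : ℝ) : ℂ) else 0

/-- The magnified fluctuation `Tr[X(f_1) ⋯ X(f_n)] - N α(f_1, ..., f_n)`. -/
def fluctuation {N : ℕ} {Ω : Type*} (X : H → Ω → Matrix (Fin N) (Fin N) ℂ)
    {n : ℕ} (f : Fin n → H) (ω : Ω) : ℂ :=
  Matrix.trace (List.ofFn fun k => X (f k) ω).prod - (N : ℂ) * ((alpha f : ℝ) : ℂ)

end HilbertSpace

end SecondOrder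

end

/-! The engine is Gaussian integration by parts: under the expectation, multiplication by an entry
acts as the derivation that contracts this entry with all others (`integral_X_mul_aeval`, abstracted
as `IsWick`). Apply it to the first letter of a trace. A contraction inside the same trace splits it
into two traces; a contraction with another trace merges the two into one; each contraction costs a
factor `1/N`. Write every trace as fluctuation plus `N α`. The split terms of order `N` are
cancelled by the centering, because `α` satisfies the Catalan-type recursion `alphaList_cons`. What
remains is the loop equation `IsWick.fluctMoment_cons`: terms of order one and terms with an
explicit `1/N`. By induction on the number of letters all mixed moments of the fluctuations
converge, and the limits obey the same recursion as the moments `wickSum` of a Gaussian family with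
covariance `covList` (`tendsto_fluctMoment`).

That `covList` is the sum over annular non-crossing pairings is not proved by cutting annular
pairings open. The genus expansion writes the covariance of two traces as a sum, over the pairings
that connect the circles, of weights times powers of `N` with exponent `#(γπ) - (n+m)/2`. The loop
equation has already shown that this has the limit `covList`. A polynomial in `N` divided by `N^e`
that has a finite limit has its coefficient of `N^e` as the limit, and this coefficient is the
annular sum (`limitCov_eq_covList`). No genus inequality is needed.

The limit family must be constructed. Conjugating a fluctuation reverses its word, so the kernel
"covariance of `s` with reversed `t`" is a limit of Hermitian covariances, hence real, symmetric and
positive semidefinite. A real Gaussian process with this kernel comes from an RKHS feature map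
followed by an isonormal process; `conjCombination` turns it into a complex family with the right
pseudo-covariance and the right behaviour under conjugation.

Convergence in distribution is the method of moments. Since conjugates of fluctuations are again
fluctuations, mixed moments without conjugates determine the moments of all real linear functionals,
and the exponential moments of the Gaussian limit give convergence of characteristic functions. -/

open scoped ENNReal NNReal Topology

namespace SecondOrder

/-! ### Finite moments and one-dimensional Gaussian integration by parts -/

section Moments

variable {Ω : Type*} {mΩ : MeasurableSpace Ω} {P : Measure Ω}

/-- A complex random variable all of whose moments are finite. -/
def HasMoments (x : Ω → ℂ) (P : Measure Ω) : Prop := ∀ p : ℝ≥0∞, p ≠ ∞ → MemLp x p P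

theorem HasMoments.integrable {x : Ω → ℂ} (h : HasMoments x P) : Integrable x P :=
  memLp_one_iff_integrable.1 (h 1 ENNReal.one_ne_top)

theorem hasMoments_const [IsFiniteMeasure P] (c : ℂ) : HasMoments (fun _ => c) P :=
  fun _ _ => memLp_const c

theorem HasMoments.add {x y : Ω → ℂ} (hx : HasMoments x P) (hy : HasMoments y P) :
    HasMoments (fun ω => x ω + y ω) P :=
  fun p hp => (hx p hp).add (hy p hp)

theorem HasMoments.mul {x y : Ω → ℂ} (hx : HasMoments x P) (hy : HasMoments y P) :
    HasMoments (fun ω => x ω * y ω) P := by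
  intro p hp
  have h2 : 2 * p ≠ ∞ := ENNReal.mul_ne_top (by simp) hp
  have : ENNReal.HolderTriple (2 * p) (2 * p) p := by
    constructor
    rcases eq_or_ne p 0 with rfl | h0
    · simp
    rw [ENNReal.mul_inv (by simp) (by simp), ← add_mul, ENNReal.inv_two_add_inv_two, one_mul]
  exact (hy (2 * p) h2).mul (hx (2 * p) h2)

theorem HasMoments.const_mul {x : Ω → ℂ} (c : ℂ) (hx : HasMoments x P) :
    HasMoments (fun ω => c * x ω) P := fun p hp => (hx p hp).const_mul c

theorem HasMoments.finset_prod [IsFiniteMeasure P] {κ : Type*} {x : κ → Ω → ℂ} (S : Finset κ)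
    (hx : ∀ k ∈ S, HasMoments (x k) P) : HasMoments (fun ω => ∏ k ∈ S, x k ω) P := by
  classical
  induction S using Finset.induction_on with
  | empty => simpa using hasMoments_const 1
  | insert a S ha ih =>
    simp only [Finset.prod_insert ha]
    exact (hx a (by simp)).mul (ih fun k hk => hx k (by simp [hk]))

theorem HasMoments.finset_sum {κ : Type*} {x : κ → Ω → ℂ} (S : Finset κ)
    (hx : ∀ k ∈ S, HasMoments (x k) P) : HasMoments (fun ω => ∑ k ∈ S, x k ω) P :=
  fun p hp => memLp_finsetSum S fun k hk => hx k hk p hp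

theorem HasMoments.pow [IsFiniteMeasure P] {x : Ω → ℂ} (hx : HasMoments x P) (n : ℕ) :
    HasMoments (fun ω => x ω ^ n) P := by
  simpa using HasMoments.finset_prod (x := fun _ : ℕ => x) (Finset.range n) fun _ _ => hx

theorem HasMoments.congr {x y : Ω → ℂ} (hx : HasMoments x P) (h : x =ᵐ[P] y) :
    HasMoments y P := fun p hp => (hx p hp).ae_eq h

theorem hasMoments_ofReal_gaussianReal (m : ℝ) (v : ℝ≥0) :
    HasMoments (fun s : ℝ => (s : ℂ)) (gaussianReal m v) :=
  fun p hp => (memLp_id_gaussianReal' p hp).ofReal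

theorem hasMoments_eval_gaussianReal (m : ℝ) (v : ℝ≥0) (p : Polynomial ℂ) :
    HasMoments (fun s : ℝ => p.eval (s : ℂ)) (gaussianReal m v) := by
  induction p using Polynomial.induction_on' with
  | add p q hp hq => simpa using hp.add hq
  | monomial n a =>
    simpa using ((hasMoments_ofReal_gaussianReal m v).pow n).const_mul a

theorem hasDerivAt_gaussianPDFReal {v : ℝ≥0} (hv : v ≠ 0) (s : ℝ) :
    HasDerivAt (fun s => (gaussianPDFReal 0 v s : ℂ)) (-(s / v) * gaussianPDFReal 0 v s) s := by
  have h : HasDerivAt (gaussianPDFReal 0 v) (-(s / v) * gaussianPDFReal 0 v s) s := by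
    have hv' : (v : ℝ) ≠ 0 := by exact_mod_cast hv
    rw [gaussianPDFReal_def]
    have h1 : HasDerivAt (fun x : ℝ => -(x - 0) ^ 2 / (2 * (v : ℝ))) (-(s / v)) s := by
      refine (((((hasDerivAt_id' s).sub_const 0).pow 2).neg).div_const (2 * (v : ℝ))).congr_deriv ?_
      simp
      field_simp
    exact (h1.exp.const_mul ((√(2 * Real.pi * v))⁻¹)).congr_deriv (by ring)
  simpa using h.ofReal_comp

theorem integrable_eval_mul_gaussianPDFReal {v : ℝ≥0} (hv : v ≠ 0) (p : Polynomial ℂ) :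
    Integrable (fun s : ℝ => p.eval (s : ℂ) * (gaussianPDFReal 0 v s : ℂ)) := by
  have h := (hasMoments_eval_gaussianReal 0 v p).integrable
  rw [gaussianReal_of_var_ne_zero _ hv,
    integrable_withDensity_iff_integrable_smul' (measurable_gaussianPDF _ _)
      (Filter.Eventually.of_forall fun x => gaussianPDF_lt_top)] at h
  refine h.congr (Filter.Eventually.of_forall fun s => ?_)
  simp [mul_comm]

/-- Gaussian integration by parts for polynomials in one variable. -/
theorem integral_mul_eval_gaussianReal (v : ℝ≥0) (p : Polynomial ℂ) :
    ∫ s : ℝ, (s : ℂ) * p.eval (s : ℂ) ∂(gaussianReal 0 v)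
      = v * ∫ s : ℝ, p.derivative.eval (s : ℂ) ∂(gaussianReal 0 v) := by
  rcases eq_or_ne v 0 with rfl | hv
  · simp
  have hv' : (v : ℂ) ≠ 0 := by exact_mod_cast hv
  -- The centered density `ρ` satisfies `ρ' = -(s/v) ρ`, so the factor `s` is moved onto the
  -- polynomial as a derivative.
  have key := integral_mul_deriv_eq_deriv_mul_of_integrable (A := ℂ)
    (u := fun s : ℝ => p.eval (s : ℂ)) (u' := fun s : ℝ => p.derivative.eval (s : ℂ))
    (v := fun s => (gaussianPDFReal 0 v s : ℂ))
    (v' := fun s => -(s / v) * gaussianPDFReal 0 v s)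
    (fun s _ => (p.hasDerivAt (s : ℂ)).comp_ofReal)
    (fun s _ => hasDerivAt_gaussianPDFReal hv s)
    (by
      refine (integrable_eval_mul_gaussianPDFReal hv
        (p * (Polynomial.C (-(1 / (v : ℂ))) * Polynomial.X))).congr
          (Filter.Eventually.of_forall fun s => ?_)
      simp
      ring)
    (integrable_eval_mul_gaussianPDFReal hv _)
    (integrable_eval_mul_gaussianPDFReal hv _)
  rw [integral_gaussianReal_eq_integral_smul hv, integral_gaussianReal_eq_integral_smul hv,
    ← integral_const_mul]
  have h2 : ∫ s : ℝ, gaussianPDFReal 0 v s • ((s : ℂ) * p.eval (s : ℂ))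
      = -v * ∫ s : ℝ, p.eval (s : ℂ) * (-(s / v) * gaussianPDFReal 0 v s) := by
    rw [← integral_const_mul]
    congr 1
    ext s
    simp
    field_simp
  rw [h2, key, integral_const_mul]
  simp [mul_comm]

theorem integral_mul_prod_gaussianReal {κ : Type*} [DecidableEq κ] (v : ℝ≥0) (S : Finset κ)
    (c y : κ → ℂ) :
    ∫ s : ℝ, (s : ℂ) * ∏ k ∈ S, (c k * s + y k) ∂(gaussianReal 0 v)
      = ∑ k ∈ S, v * c k * ∫ s : ℝ, ∏ l ∈ S.erase k, (c l * s + y l) ∂(gaussianReal 0 v) := by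
  have h := integral_mul_eval_gaussianReal v
    (∏ k ∈ S, (Polynomial.C (c k) * Polynomial.X + Polynomial.C (y k)))
  simp only [Polynomial.eval_prod, Polynomial.eval_add, Polynomial.eval_mul, Polynomial.eval_C,
    Polynomial.eval_X, Polynomial.derivative_prod_finset, Polynomial.derivative_add,
    Polynomial.derivative_mul, Polynomial.derivative_C, Polynomial.derivative_X, zero_mul,
    zero_add, add_zero, mul_one, Polynomial.eval_finsetSum] at h
  rw [h, integral_finsetSum, Finset.mul_sum]
  · refine Finset.sum_congr rfl fun k _ => ?_
    rw [integral_mul_const]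
    ring
  · intro k _
    refine Integrable.mul_const ?_ _
    have := (hasMoments_eval_gaussianReal 0 v
      (∏ k ∈ S.erase k, (Polynomial.C (c k) * Polynomial.X + Polynomial.C (y k)))).integrable
    simpa [Polynomial.eval_prod] using this

end Moments

/-! ### Wick's formula for complex Gaussian vectors -/

section Wick

variable {Ω : Type*} {mΩ : MeasurableSpace Ω} {P : Measure Ω}

theorem hasMoments_of_hasGaussianLaw {x : Ω → ℂ} (hx : HasGaussianLaw x P) : HasMoments x P :=
  fun _ hp => hx.memLp hp

theorem strongDual_pi_complex {κ : Type*} [Fintype κ] [DecidableEq κ] (L : StrongDual ℝ (κ → ℂ))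
    (z : κ → ℂ) :
    L z = ∑ k, (L (Pi.single k 1) * (z k).re + L (Pi.single k Complex.I) * (z k).im) := by
  conv_lhs => rw [← Finset.univ_sum_single z]
  rw [map_sum]
  refine Finset.sum_congr rfl fun k _ => ?_
  have : (Pi.single k (z k) : κ → ℂ)
      = (z k).re • (Pi.single k 1 : κ → ℂ) + (z k).im • (Pi.single k Complex.I : κ → ℂ) := by
    rw [← Pi.single_smul, ← Pi.single_smul, ← Pi.single_add]
    congr 1
    apply Complex.ext <;> simp
  rw [this, map_add, map_smul, map_smul]
  simp [mul_comm]

variable {κ : Type*} [Fintype κ] [DecidableEq κ] {x : κ → Ω → ℂ}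

/-- Gaussian regression on the real variable `r = L (x a)`: write `x k = c k * r + y k` with `y`
uncorrelated with `r`, hence independent of it. For fixed `y` the product is a polynomial in `r`,
and one-dimensional integration by parts applies. Taking `r` real keeps the regression
one-dimensional; a complex `x a` is recovered from its real and imaginary parts. -/
theorem integral_real_mul_prod (hx : HasGaussianLaw (fun ω k => x k ω) P)
    (h0 : ∀ k, ∫ ω, x k ω ∂P = 0) (a : κ) (L : ℂ →L[ℝ] ℝ) (S : Finset κ) :
    ∫ ω, (L (x a ω) : ℂ) * ∏ k ∈ S, x k ω ∂P
      = ∑ k ∈ S, (∫ ω, (L (x a ω) : ℂ) * x k ω ∂P) * ∫ ω, ∏ l ∈ S.erase k, x l ω ∂P := by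
  have := hx.isProbabilityMeasure
  set r : Ω → ℝ := fun ω => L (x a ω) with hr
  have hxk : ∀ k, HasGaussianLaw (x k) P := fun k => hx.eval k
  have hrG : HasGaussianLaw r P := (hxk a).map L
  have hr0 : ∫ ω, r ω ∂P = 0 := by
    rw [hr, L.integral_comp_comm (hxk a).integrable, h0, map_zero]
  set v : ℝ := Var[r; P] with hv
  have hrm : HasMoments (fun ω => (r ω : ℂ)) P := fun p hp => (hrG.memLp hp).ofReal
  have hrr : ∫ ω, r ω * r ω ∂P = v := by
    rw [hv, variance_eq_integral hrG.aemeasurable, hr0]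
    simp [sq]
  have hrrC : ∫ ω, (r ω : ℂ) * r ω ∂P = v := by
    rw [← hrr, ← integral_complex_ofReal]
    simp
  -- If the variance vanishes, `r` is almost surely zero and there is nothing to regress on.
  rcases eq_or_ne v 0 with hv0 | hv0
  · have hr00 : r =ᵐ[P] fun _ => 0 := by
      have := ae_eq_integral_of_variance_eq_zero hrG.memLp_two hv0
      rwa [hr0] at this
    have e1 : ∀ f : Ω → ℂ, ∫ ω, (r ω : ℂ) * f ω ∂P = 0 := fun f =>
      integral_eq_zero_of_ae (by filter_upwards [hr00] with ω h; simp [h])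
    rw [e1]
    exact (Finset.sum_eq_zero fun k _ => by rw [e1, zero_mul]).symm
  have hv0C : (v : ℂ) ≠ 0 := by exact_mod_cast hv0
  -- The regression coefficients are chosen so that `r` and the residuals `y` are uncorrelated.
  set c : κ → ℂ := fun k => (∫ ω, (r ω : ℂ) * x k ω ∂P) / v with hc
  set y : Ω → κ → ℂ := fun ω k => x k ω - c k * r ω with hy
  let A : (κ → ℂ) →L[ℝ] ℝ × (κ → ℂ) :=
    (L.comp (.proj a)).prod (.pi fun k => .proj k -
      (((ContinuousLinearMap.mul ℝ ℂ) (c k)).comp (Complex.ofRealCLM.comp (L.comp (.proj a)))))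
  have hG : HasGaussianLaw (fun ω => (r ω, y ω)) P := hx.map A
  have hyk : ∀ k, HasGaussianLaw (fun ω => y ω k) P := fun k => hG.snd.eval k
  have hry : ∀ k, ∫ ω, (r ω : ℂ) * y ω k ∂P = 0 := by
    intro k
    have : ∀ ω, (r ω : ℂ) * y ω k = (r ω : ℂ) * x k ω - c k * (r ω * r ω) := fun ω => by
      simp only [hy]; ring
    simp_rw [this]
    rw [integral_sub (hrm.mul (hasMoments_of_hasGaussianLaw (hxk k))).integrable
      ((hrm.mul hrm).const_mul _).integrable, integral_const_mul, hrrC]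
    simp only [hc]
    field_simp
    ring
  have hind : IndepFun r y P := by
    -- Joint Gaussianity reduces independence to vanishing covariances with real functionals of `y`.
    -- These are combinations of real and imaginary parts, and since `r` is real, `E[r y k] = 0`
    -- kills both.
    refine hG.indepFun_of_covariance_strongDual fun L₁ L₂ => ?_
    have hL₁ : L₁ ∘ r = fun ω => L₁ 1 * r ω := by
      ext ω
      have : L₁ (r ω • 1) = r ω • L₁ 1 := map_smul _ _ _
      simpa [mul_comm] using this
    have hL₂ : L₂ ∘ y = fun ω => ∑ k, (L₂ (Pi.single k 1) * (y ω k).re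
        + L₂ (Pi.single k Complex.I) * (y ω k).im) := by
      ext ω
      exact strongDual_pi_complex L₂ (y ω)
    have hre : ∀ k, HasGaussianLaw (fun ω => (y ω k).re) P := fun k => (hyk k).map Complex.reCLM
    have him : ∀ k, HasGaussianLaw (fun ω => (y ω k).im) P := fun k => (hyk k).map Complex.imCLM
    have hint : ∀ k, Integrable (fun ω => (r ω : ℂ) * y ω k) P := fun k =>
      (hrm.mul (hasMoments_of_hasGaussianLaw (hyk k))).integrable
    have cre : ∀ k, cov[r, fun ω => (y ω k).re; P] = 0 := by
      intro k
      rw [covariance_eq_sub hrG.memLp_two (hre k).memLp_two, hr0, zero_mul, sub_zero]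
      have := Complex.reCLM.integral_comp_comm (hint k)
      rw [hry] at this
      simpa using this
    have cim : ∀ k, cov[r, fun ω => (y ω k).im; P] = 0 := by
      intro k
      rw [covariance_eq_sub hrG.memLp_two (him k).memLp_two, hr0, zero_mul, sub_zero]
      have := Complex.imCLM.integral_comp_comm (hint k)
      rw [hry] at this
      simpa using this
    rw [hL₁, hL₂, covariance_const_mul_left, covariance_fun_sum_right]
    · rw [Finset.sum_eq_zero, mul_zero]
      intro k _
      refine (covariance_add_right hrG.memLp_two ((hre k).memLp_two.const_mul _)
        ((him k).memLp_two.const_mul _)).trans ?_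
      rw [covariance_const_mul_right, covariance_const_mul_right, cre, cim]
      simp
    · exact fun k => ((hre k).memLp_two.const_mul _).add ((him k).memLp_two.const_mul _)
    · exact hrG.memLp_two
  have hmap : P.map (fun ω => (r ω, y ω)) = (gaussianReal 0 v.toNNReal).prod (P.map y) := by
    rw [(indepFun_iff_map_prod_eq_prod_map_map hrG.aemeasurable hG.snd.aemeasurable).1 hind,
      hrG.map_eq_gaussianReal, hr0]
  have hvv : ((v.toNNReal : ℝ) : ℂ) = v := by
    rw [Real.coe_toNNReal _ (variance_nonneg _ _)]
  have hae : AEMeasurable (fun ω => (r ω, y ω)) P := hG.aemeasurable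
  have hxy : ∀ k ω, x k ω = c k * r ω + y ω k := fun k ω => by simp [hy]
  have hm1 : ∀ T : Finset κ, Measurable fun p : ℝ × (κ → ℂ) => ∏ k ∈ T, (c k * p.1 + p.2 k) := by
    intro T
    fun_prop
  have hm2 : ∀ T : Finset κ,
      Measurable fun p : ℝ × (κ → ℂ) => (p.1 : ℂ) * ∏ k ∈ T, (c k * p.1 + p.2 k) := by
    intro T
    exact Measurable.mul (by fun_prop) (hm1 T)
  have hpm : ∀ T : Finset κ, HasMoments (fun ω => ∏ k ∈ T, x k ω) P := fun T =>
    HasMoments.finset_prod T fun k _ => hasMoments_of_hasGaussianLaw (hxk k)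
  have hI1 : ∀ T : Finset κ, Integrable (fun p : ℝ × (κ → ℂ) => ∏ k ∈ T, (c k * p.1 + p.2 k))
      ((gaussianReal 0 v.toNNReal).prod (P.map y)) := by
    intro T
    rw [← hmap, integrable_map_measure (hm1 T).aestronglyMeasurable hae]
    simpa [Function.comp_def, ← hxy] using (hpm T).integrable
  have hI2 : ∀ T : Finset κ,
      Integrable (fun p : ℝ × (κ → ℂ) => (p.1 : ℂ) * ∏ k ∈ T, (c k * p.1 + p.2 k))
      ((gaussianReal 0 v.toNNReal).prod (P.map y)) := by
    intro T
    rw [← hmap, integrable_map_measure (hm2 T).aestronglyMeasurable hae]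
    simpa [Function.comp_def, ← hxy] using (hrm.mul (hpm T)).integrable
  have hE1 : ∀ T : Finset κ, ∫ ω, ∏ k ∈ T, x k ω ∂P
      = ∫ z, ∫ s : ℝ, ∏ k ∈ T, (c k * s + z k) ∂(gaussianReal 0 v.toNNReal) ∂(P.map y) := by
    intro T
    rw [← integral_prod_symm _ (hI1 T), ← hmap,
      integral_map hae (hm1 T).aestronglyMeasurable]
    simp [← hxy]
  have hyP : IsProbabilityMeasure (P.map y) := Measure.isProbabilityMeasure_map hG.snd.aemeasurable
  have hE2 : ∫ ω, (r ω : ℂ) * ∏ k ∈ S, x k ω ∂P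
      = ∫ z, ∫ s : ℝ, (s : ℂ) * ∏ k ∈ S, (c k * s + z k) ∂(gaussianReal 0 v.toNNReal)
        ∂(P.map y) := by
    rw [← integral_prod_symm _ (hI2 S), ← hmap,
      integral_map hae (hm2 S).aestronglyMeasurable]
    simp [← hxy]
  rw [hE2]
  simp_rw [integral_mul_prod_gaussianReal]
  rw [integral_finsetSum]
  · refine Finset.sum_congr rfl fun k _ => ?_
    rw [integral_const_mul, ← hE1, hvv]
    congr 1
    simp only [hc]
    exact mul_div_cancel₀ _ hv0C
  · intro k _
    exact ((hI1 (S.erase k)).integral_prod_right).const_mul _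

/-- **Wick's formula** for centered, jointly Gaussian complex random variables, in recursive
form. -/
theorem integral_mul_prod (hx : HasGaussianLaw (fun ω k => x k ω) P)
    (h0 : ∀ k, ∫ ω, x k ω ∂P = 0) (a : κ) (S : Finset κ) :
    ∫ ω, x a ω * ∏ k ∈ S, x k ω ∂P
      = ∑ k ∈ S, (∫ ω, x a ω * x k ω ∂P) * ∫ ω, ∏ l ∈ S.erase k, x l ω ∂P := by
  have := hx.isProbabilityMeasure
  have hxk : ∀ k, HasMoments (x k) P := fun k => hasMoments_of_hasGaussianLaw (hx.eval k)
  have hre : HasMoments (fun ω => (Complex.reCLM (x a ω) : ℂ)) P := fun p hp =>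
    (((hx.eval a).map Complex.reCLM).memLp hp).ofReal
  have him : HasMoments (fun ω => (Complex.imCLM (x a ω) : ℂ)) P := fun p hp =>
    (((hx.eval a).map Complex.imCLM).memLp hp).ofReal
  have split : ∀ f : Ω → ℂ, HasMoments f P → ∫ ω, x a ω * f ω ∂P
      = (∫ ω, (Complex.reCLM (x a ω) : ℂ) * f ω ∂P)
        + Complex.I * ∫ ω, (Complex.imCLM (x a ω) : ℂ) * f ω ∂P := by
    intro f hf
    rw [← integral_const_mul, ← integral_add (hre.mul hf).integrable
      ((him.mul hf).const_mul _).integrable]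
    congr 1
    ext ω
    conv_lhs => rw [← Complex.re_add_im (x a ω)]
    simp only [Complex.reCLM_apply, Complex.imCLM_apply]
    ring
  rw [split _ (HasMoments.finset_prod S fun k _ => hxk k), integral_real_mul_prod hx h0,
    integral_real_mul_prod hx h0, Finset.mul_sum, ← Finset.sum_add_distrib]
  refine Finset.sum_congr rfl fun k _ => ?_
  rw [split _ (hxk k)]
  ring

end Wick

/-! ### Integration by parts for polynomials in a Gaussian process -/

theorem derivation_prod {A ι : Type*} [CommRing A] [Algebra ℂ A] [DecidableEq ι]
    (D : Derivation ℂ A A) (S : Finset ι) (f : ι → A) :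
    D (∏ k ∈ S, f k) = ∑ k ∈ S, (∏ l ∈ S.erase k, f l) * D (f k) := by
  induction S using Finset.induction_on with
  | empty => simp
  | insert a S ha ih =>
    rw [Finset.prod_insert ha, D.leibniz, ih, Finset.sum_insert ha, Finset.erase_insert ha,
      smul_eq_mul, smul_eq_mul, add_comm, Finset.mul_sum]
    congr 1
    refine Finset.sum_congr rfl fun k hk => ?_
    have hka : a ≠ k := fun h => ha (h ▸ hk)
    rw [Finset.erase_insert_of_ne hka, Finset.prod_insert (by simp [ha]), mul_assoc]

theorem hasGaussianLaw_pi {Ω T κ : Type*} {mΩ : MeasurableSpace Ω} {P : Measure Ω} [Fintype κ]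
    {X : T → Ω → ℂ} (hX : IsGaussianProcess X P) (b : κ → T) :
    HasGaussianLaw (fun ω k => X (b k) ω) P := by
  classical
  let A : (↥(Finset.image b Finset.univ) → ℂ) →L[ℝ] (κ → ℂ) :=
    .pi fun k => .proj ⟨b k, by simp⟩
  exact (hX.hasGaussianLaw (Finset.image b Finset.univ)).map A

section Polynomial

variable {Ω T : Type*} {mΩ : MeasurableSpace Ω} {P : Measure Ω} {X : T → Ω → ℂ}

theorem hasMoments_aeval [IsFiniteMeasure P] (hX : ∀ t, HasMoments (X t) P)
    (p : MvPolynomial T ℂ) :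
    HasMoments (fun ω => MvPolynomial.aeval (fun t => X t ω) p) P := by
  induction p using MvPolynomial.induction_on with
  | C a => simpa using hasMoments_const a
  | add p q hp hq => simpa using hp.add hq
  | mul_X p t hp => simpa using hp.mul (hX t)

/-- Listing the variables of a monomial with multiplicity lets Wick's formula, stated for products
over a finite index set, apply to powers. -/
theorem exists_monomial_eq_prod (s : T →₀ ℕ) :
    ∃ (n : ℕ) (b : Fin n → T),
      (MvPolynomial.monomial s 1 : MvPolynomial T ℂ) = ∏ k, MvPolynomial.X (b k) := by
  induction s using Finsupp.induction_linear with
  | zero => exact ⟨0, Fin.elim0, by simp⟩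
  | add f g hf hg =>
    obtain ⟨n, b, hb⟩ := hf
    obtain ⟨m, c, hc⟩ := hg
    refine ⟨n + m, Fin.append b c, ?_⟩
    rw [Fin.prod_univ_add]
    simp [← hb, ← hc, MvPolynomial.monomial_mul]
  | single t n => exact ⟨n, fun _ => t, by simp [MvPolynomial.X_pow_eq_monomial]⟩

/-- Gaussian integration by parts: multiplication by a variable acts under the expectation as the
derivation that contracts this variable with the others. -/
theorem integral_X_mul_aeval (hX : IsGaussianProcess X P) (h0 : ∀ t, ∫ ω, X t ω ∂P = 0) (a : T)
    (c : T → ℂ) (hc : ∀ t, ∫ ω, X a ω * X t ω ∂P = c t) (p : MvPolynomial T ℂ) :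
    ∫ ω, X a ω * MvPolynomial.aeval (fun t => X t ω) p ∂P
      = ∫ ω, MvPolynomial.aeval (fun t => X t ω)
          (MvPolynomial.mkDerivation ℂ (fun t => MvPolynomial.C (c t)) p) ∂P := by
  have := hX.isProbabilityMeasure
  have hm : ∀ t, HasMoments (X t) P := fun t => hasMoments_of_hasGaussianLaw (hX.hasGaussianLaw_eval t)
  have hmp := hasMoments_aeval hm
  induction p using MvPolynomial.induction_on' with
  | add p q hp hq =>
    simp only [map_add, mul_add]
    rw [integral_add ((hm a).mul (hmp p)).integrable ((hm a).mul (hmp q)).integrable,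
      integral_add (hmp _).integrable (hmp _).integrable, hp, hq]
  | monomial s r =>
    obtain ⟨n, b, hb⟩ := exists_monomial_eq_prod s
    have hs : (MvPolynomial.monomial s r : MvPolynomial T ℂ) = r • ∏ k, MvPolynomial.X (b k) := by
      rw [← hb, MvPolynomial.smul_monomial, smul_eq_mul, mul_one]
    -- The index `none` carries the distinguished variable `a`, kept apart from the factors because
    -- `a` may itself occur in the monomial.
    let b' : Option (Fin n) → T := fun o => o.elim a b
    have key := integral_mul_prod (x := fun k ω => X (b' k) ω) (hasGaussianLaw_pi hX b')
      (fun k => h0 _) none (Finset.univ.map Function.Embedding.some)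
    have hmap : ∀ S : Finset (Fin n), ∀ ω, ∏ l ∈ S.map Function.Embedding.some, X (b' l) ω
        = ∏ l ∈ S, X (b l) ω := fun S ω => by simp [b']
    have herase : ∀ k : Fin n, (Finset.univ.map Function.Embedding.some).erase (some k)
        = ((Finset.univ : Finset (Fin n)).erase k).map Function.Embedding.some := fun k => by
      rw [Finset.map_erase]
      rfl
    rw [Finset.sum_map] at key
    simp only [Function.Embedding.some_apply, herase, hmap] at key
    rw [hs, Derivation.map_smul, derivation_prod]
    simp only [map_smul, map_prod, map_sum, map_mul, MvPolynomial.aeval_X,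
      MvPolynomial.mkDerivation_X, MvPolynomial.aeval_C, Algebra.algebraMap_self, RingHom.id_apply,
      smul_eq_mul]
    simp_rw [mul_left_comm _ r]
    rw [integral_const_mul, integral_const_mul, integral_finsetSum]
    · congr 1
      refine key.trans (Finset.sum_congr rfl fun k _ => ?_)
      rw [integral_mul_const, mul_comm]
      congr 1
      exact hc (b k)
    · intro k _
      exact ((HasMoments.finset_prod _ fun l _ => hm (b l)).integrable).mul_const _

end Polynomial

/-! ### Recursions for sums over pairings and non-crossing pairings -/

section Involutions

variable {α : Type*} [LinearOrder α] [Fintype α] {R : Type*} [CommRing R]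

/-- `p` is a pairing of the finite set `S`, extended by the identity. -/
structure PairsOn (S : Finset α) (p : α → α) : Prop where
  fix : ∀ i, i ∉ S → p i = i
  ne : ∀ i ∈ S, p i ≠ i
  invol : ∀ i, p (p i) = i

/-- The non-crossing condition. -/
def NonCross (p : α → α) : Prop := ∀ i j, ¬ (i < j ∧ j < p i ∧ p i < p j)

/-- The product of `c i (p i)` over the blocks `{i < p i}`. -/
def blockProd (c : α → α → R) (p : α → α) : R := ∏ i, if i < p i then c i (p i) else 1

open Classical in
/-- The sum of `blockProd` over all pairings of `S`. -/
noncomputable def pairSum (c : α → α → R) (S : Finset α) : R := ∑ p with PairsOn S p, blockProd c p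

open Classical in
/-- The sum of `blockProd` over all non-crossing pairings of `S`. -/
noncomputable def ncSum (c : α → α → R) (S : Finset α) : R :=
  ∑ p with PairsOn S p ∧ NonCross p, blockProd c p

omit [Fintype α] in
theorem PairsOn.mem {S : Finset α} {p : α → α} (h : PairsOn S p) {i : α} (hi : i ∈ S) :
    p i ∈ S := by
  by_contra hc
  have := h.fix _ hc
  rw [h.invol] at this
  exact h.ne i hi this.symm

theorem pairSum_empty (c : α → α → R) : pairSum c ∅ = 1 := by
  classical
  have : (Finset.univ.filter fun p : α → α => PairsOn ∅ p) = {id} := by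
    ext p
    simp only [Finset.mem_filter, Finset.mem_univ, true_and, Finset.mem_singleton]
    constructor
    · intro h
      ext i
      exact h.fix i (by simp)
    · rintro rfl
      exact ⟨fun _ _ => rfl, by simp, fun _ => rfl⟩
  rw [pairSum, this]
  simp [blockProd]

/-- Classify the pairings by the partner `k` of `a` and remove that block. Minimality of `a` ensures
that the removed factor is `c a k` and not `c k a`; no symmetry of `c` is assumed. -/
theorem pairSum_eq (c : α → α → R) (S : Finset α) (a : α) (ha : a ∈ S) (hmin : ∀ i ∈ S, a ≤ i) :
    pairSum c S = ∑ k ∈ S.erase a, c a k * pairSum c ((S.erase a).erase k) := by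
  classical
  rw [pairSum, ← Finset.sum_fiberwise_of_maps_to (t := S.erase a) (g := fun p => p a)]
  swap
  · intro p hp
    have hp := (Finset.mem_filter.1 hp).2
    exact Finset.mem_erase.2 ⟨hp.ne a ha, hp.mem ha⟩
  refine Finset.sum_congr rfl fun k hk => ?_
  obtain ⟨hka, hkS⟩ := Finset.mem_erase.1 hk
  have hak : a < k := lt_of_le_of_ne (hmin k hkS) (Ne.symm hka)
  rw [pairSum, Finset.mul_sum]
  refine Finset.sum_nbij' (fun p i => if i = a ∨ i = k then i else p i)
    (fun p i => if i = a then k else if i = k then a else p i) ?_ ?_ ?_ ?_ ?_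
  · intro p hp
    simp only [Finset.mem_filter, Finset.mem_univ, true_and] at hp ⊢
    obtain ⟨⟨h1, h2, h3⟩, h4⟩ := hp
    refine ⟨?_, ?_, ?_⟩ <;> grind
  · intro p hp
    simp only [Finset.mem_filter, Finset.mem_univ, true_and] at hp ⊢
    have hm := @PairsOn.mem _ _ _ _ hp
    obtain ⟨h1, h2, h3⟩ := hp
    refine ⟨⟨?_, ?_, ?_⟩, ?_⟩ <;> grind
  · intro p hp
    simp only [Finset.mem_filter, Finset.mem_univ, true_and] at hp
    obtain ⟨⟨h1, h2, h3⟩, h4⟩ := hp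
    ext i
    grind
  · intro p hp
    simp only [Finset.mem_filter, Finset.mem_univ, true_and] at hp
    obtain ⟨h1, h2, h3⟩ := hp
    ext i
    grind
  · intro p hp
    simp only [Finset.mem_filter, Finset.mem_univ, true_and] at hp
    obtain ⟨⟨h1, h2, h3⟩, h4⟩ := hp
    have e : c a k = ∏ i, if i = a then c a k else 1 := by simp
    rw [e, blockProd, blockProd, ← Finset.prod_mul_distrib]
    refine Finset.prod_congr rfl fun i _ => ?_
    by_cases hia : i = a
    · subst hia
      simp [h4, hak]
    · by_cases hik : i = k
      · subst hik
        have : p i = a := by rw [← h4, h3]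
        simp [hia, this, hak.not_gt]
      · simp [hia, hik]

theorem ncSum_empty (c : α → α → R) : ncSum c ∅ = 1 := by
  classical
  have : (Finset.univ.filter fun p : α → α => PairsOn ∅ p ∧ NonCross p) = {id} := by
    ext p
    simp only [Finset.mem_filter, Finset.mem_univ, true_and, Finset.mem_singleton]
    constructor
    · intro h
      ext i
      exact h.1.fix i (by simp)
    · rintro rfl
      refine ⟨⟨fun _ _ => rfl, by simp, fun _ => rfl⟩, ?_⟩
      rintro i j ⟨h1, h2, -⟩
      exact lt_asymm h1 h2
  rw [ncSum, this]
  simp [blockProd]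

/-- Catalan recursion: the block `{a, k}` of the minimum separates the points between `a` and `k`
from those beyond `k`, and in a non-crossing pairing no block joins the two regions. -/
theorem ncSum_eq (c : α → α → R) (S : Finset α) (a : α) (ha : a ∈ S) (hmin : ∀ i ∈ S, a ≤ i) :
    ncSum c S = ∑ k ∈ S.erase a, c a k *
      (ncSum c (S.filter fun i => a < i ∧ i < k) * ncSum c (S.filter fun i => k < i)) := by
  classical
  rw [ncSum, ← Finset.sum_fiberwise_of_maps_to (t := S.erase a) (g := fun p => p a)]
  swap
  · intro p hp
    have hp := (Finset.mem_filter.1 hp).2.1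
    exact Finset.mem_erase.2 ⟨hp.ne a ha, hp.mem ha⟩
  refine Finset.sum_congr rfl fun k hk => ?_
  obtain ⟨hka, hkS⟩ := Finset.mem_erase.1 hk
  have hak : a < k := lt_of_le_of_ne (hmin k hkS) (Ne.symm hka)
  rw [ncSum, ncSum, Finset.sum_mul_sum, ← Finset.sum_product', Finset.mul_sum]
  -- A block leaving the interval between `a` and `k` would cross `{a, k}`, so both regions are
  -- stable under the pairing and it can be restricted to each.
  have hin : ∀ p : α → α, PairsOn S p → NonCross p → p a = k →
      (∀ i, a < i → i < k → a < p i ∧ p i < k) ∧ (∀ i, k < i → k < p i) := by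
    intro p hp hnc hpa
    have hpk : p k = a := by rw [← hpa, hp.invol]
    have h1 : ∀ i, a < i → i < k → a < p i ∧ p i < k := by
      intro i hai hik
      by_cases hiS : i ∈ S
      · have hm := hmin _ (hp.mem hiS)
        have hia : p i ≠ a := fun h => by
          have := hp.invol i
          rw [h, hpa] at this
          exact hik.ne this.symm
        have hik' : p i ≠ k := fun h => by
          have := hp.invol i
          rw [h, hpk] at this
          exact hai.ne this
        refine ⟨lt_of_le_of_ne hm (Ne.symm hia), ?_⟩
        by_contra hc
        refine hnc a i ⟨hai, by rwa [hpa], ?_⟩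
        rw [hpa]
        exact lt_of_le_of_ne (not_lt.1 hc) (Ne.symm hik')
      · rw [hp.fix i hiS]
        exact ⟨hai, hik⟩
    refine ⟨h1, fun i hi => ?_⟩
    by_cases hiS : i ∈ S
    · by_contra hc
      have hm := hmin _ (hp.mem hiS)
      have h2 := hp.invol i
      rcases hm.eq_or_lt with h | h
      · rw [← h, hpa] at h2
        exact hi.ne h2
      · rcases (not_lt.1 hc).eq_or_lt with h' | h'
        · rw [h', hpk] at h2
          exact (hak.trans hi).ne h2
        · have := (h1 _ h h').2
          rw [h2] at this
          exact lt_asymm hi this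
    · rwa [hp.fix i hiS]
  refine Finset.sum_nbij'
    (fun p => (fun i => if a < i ∧ i < k then p i else i, fun i => if k < i then p i else i))
    (fun q i => if i = a then k else if i = k then a else if i < k then q.1 i else q.2 i)
    ?_ ?_ ?_ ?_ ?_
  · intro p hp
    simp only [Finset.mem_filter, Finset.mem_univ, true_and, Finset.mem_product] at hp ⊢
    obtain ⟨⟨hp, hnc⟩, hpa⟩ := hp
    obtain ⟨hin1, hin2⟩ := hin p hp hnc hpa
    obtain ⟨h1, h2, h3⟩ := hp
    refine ⟨⟨⟨?_, ?_, ?_⟩, ?_⟩, ⟨?_, ?_, ?_⟩, ?_⟩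
    · grind
    · grind
    · grind
    · intro i j
      have := hnc i j
      grind
    · grind
    · grind
    · grind
    · intro i j
      have := hnc i j
      grind
  · rintro ⟨p, q⟩ hp
    simp only [Finset.mem_filter, Finset.mem_univ, true_and, Finset.mem_product] at hp ⊢
    obtain ⟨⟨hp, hpn⟩, hq, hqn⟩ := hp
    have hpm : ∀ i, a < i → i < k → a < p i ∧ p i < k := by
      intro i h1 h2
      by_cases hi : i ∈ S
      · have := hp.mem (Finset.mem_filter.2 ⟨hi, h1, h2⟩)
        exact (Finset.mem_filter.1 this).2
      · rw [hp.fix i (by simp [hi])]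
        exact ⟨h1, h2⟩
    have hpf : ∀ i, ¬ (a < i ∧ i < k) → p i = i := fun i hi => hp.fix i (by simp [hi])
    have hqm : ∀ i, k < i → k < q i := by
      intro i h1
      by_cases hi : i ∈ S
      · have := hq.mem (Finset.mem_filter.2 ⟨hi, h1⟩)
        exact (Finset.mem_filter.1 this).2
      · rwa [hq.fix i (by simp [hi])]
    have hqf : ∀ i, ¬ (k < i) → q i = i := fun i hi => hq.fix i (by simp [hi])
    obtain ⟨p1, p2, p3⟩ := hp
    obtain ⟨q1, q2, q3⟩ := hq
    simp only [Finset.mem_filter, not_and] at p1 p2 q1 q2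
    refine ⟨⟨⟨?_, ?_, ?_⟩, ?_⟩, ?_⟩
    · grind
    · grind
    · grind
    · intro i j
      have h1 := hpn i j
      have h2 := hqn i j
      grind
    · simp
  · intro p hp
    simp only [Finset.mem_filter, Finset.mem_univ, true_and] at hp
    obtain ⟨⟨⟨h1, h2, h3⟩, h5⟩, h4⟩ := hp
    ext i
    grind
  · rintro ⟨p, q⟩ hp
    simp only [Finset.mem_filter, Finset.mem_univ, true_and, Finset.mem_product] at hp
    obtain ⟨⟨hp, hpn⟩, hq, hqn⟩ := hp
    have hpf : ∀ i, ¬ (a < i ∧ i < k) → p i = i := fun i hi => hp.fix i (by simp [hi])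
    have hqf : ∀ i, ¬ (k < i) → q i = i := fun i hi => hq.fix i (by simp [hi])
    ext i <;> grind
  · intro p hp
    simp only [Finset.mem_filter, Finset.mem_univ, true_and] at hp
    obtain ⟨⟨hp, hnc⟩, hpa⟩ := hp
    have e : c a k = ∏ i, if i = a then c a k else 1 := by simp
    rw [e, blockProd, blockProd, blockProd, ← Finset.prod_mul_distrib, ← Finset.prod_mul_distrib]
    refine Finset.prod_congr rfl fun i _ => ?_
    have hpk : p k = a := by rw [← hpa, hp.invol]
    rcases lt_trichotomy i a with h | rfl | h
    · have hi : p i = i := hp.fix i fun hi => (hmin i hi).not_gt h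
      simp [hi, h.ne, h.not_gt, (h.trans hak).not_gt]
    · simp [hpa, hak, hak.not_gt]
    · rcases lt_trichotomy i k with h' | rfl | h'
      · simp [h, h', h.ne', h'.not_gt]
      · simp [hpk, h.ne', h.not_gt]
      · simp [h, h', h.ne', h'.not_gt]

end Involutions

/-- Crossings depend only on the order. Extending by the identity off the range creates no crossing
and only factors `1`. -/
theorem ncSum_map {α β R : Type*} [LinearOrder α] [Fintype α] [LinearOrder β] [Fintype β]
    [CommRing R] (e : β ↪o α) (c : α → α → R) :
    ncSum c (Finset.univ.map e.toEmbedding) = ncSum (fun i j => c (e i) (e j)) Finset.univ := by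
  classical
  symm
  have hext : ∀ (q : β → β) j, Function.extend e (e ∘ q) id (e j) = e (q j) := fun q j =>
    e.injective.extend_apply _ _ j
  have hext' : ∀ (q : β → β) i, (¬ ∃ j, e j = i) → Function.extend e (e ∘ q) id i = i :=
    fun q i hi => Function.extend_apply' _ _ i hi
  refine Finset.sum_nbij (fun q => Function.extend e (e ∘ q) id) ?_ ?_ ?_ ?_
  · intro q hq
    simp only [Finset.mem_filter, Finset.mem_univ, true_and] at hq ⊢
    obtain ⟨⟨-, h2, h3⟩, h4⟩ := hq
    refine ⟨⟨?_, ?_, ?_⟩, ?_⟩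
    · intro i hi
      exact hext' q i (by simpa using hi)
    · intro i hi
      obtain ⟨j, rfl⟩ : ∃ j, e j = i := by simpa using hi
      rw [hext]
      exact fun h => h2 j (Finset.mem_univ _) (e.injective h)
    · intro i
      by_cases hi : ∃ j, e j = i
      · obtain ⟨j, rfl⟩ := hi
        rw [hext, hext, h3]
      · rw [hext' q i hi, hext' q i hi]
    · rintro i j ⟨hij, hji, hii⟩
      have hi : ∃ i', e i' = i := by
        by_contra hi
        rw [hext' q i hi] at hji
        exact lt_asymm hij hji
      have hj : ∃ j', e j' = j := by
        by_contra hj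
        rw [hext' q j hj] at hii
        exact lt_asymm hji hii
      obtain ⟨i', rfl⟩ := hi
      obtain ⟨j', rfl⟩ := hj
      rw [hext] at hji hii
      rw [hext] at hii
      exact h4 i' j' ⟨e.lt_iff_lt.1 hij, e.lt_iff_lt.1 hji, e.lt_iff_lt.1 hii⟩
  · intro q _ q' _ h
    ext j
    have := congrFun h (e j)
    simp only [hext] at this
    exact e.injective this
  · intro p hp
    simp only [Finset.coe_filter, Finset.mem_univ, true_and, Set.mem_ofPred_eq] at hp
    obtain ⟨hp, hnc⟩ := hp
    have : ∀ j, ∃ j', e j' = p (e j) := fun j => by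
      simpa using hp.mem (i := e j) (by simp)
    choose q hq using this
    refine ⟨q, ?_, ?_⟩
    · simp only [Finset.coe_filter, Finset.mem_univ, true_and, Set.mem_ofPred_eq]
      refine ⟨⟨by simp, ?_, ?_⟩, ?_⟩
      · intro j _ h
        have := hp.ne (e j) (by simp)
        rw [← hq, h] at this
        exact this rfl
      · intro j
        apply e.injective
        rw [hq, hq, hp.invol]
      · rintro i j ⟨h1, h2, h3⟩
        refine hnc (e i) (e j) ⟨e.lt_iff_lt.2 h1, ?_, ?_⟩
        · rw [← hq]
          exact e.lt_iff_lt.2 h2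
        · rw [← hq, ← hq]
          exact e.lt_iff_lt.2 h3
    · ext i
      by_cases hi : ∃ j, e j = i
      · obtain ⟨j, rfl⟩ := hi
        exact (hext q j).trans (hq j)
      · exact (hext' q i hi).trans (hp.fix i (by simpa using hi)).symm
  · intro q _
    rw [blockProd, blockProd, ← Finset.prod_subset (Finset.subset_univ
      (Finset.univ.map e.toEmbedding)), Finset.prod_map]
    · refine Finset.prod_congr rfl fun j _ => ?_
      simp only [RelEmbedding.coe_toEmbedding, hext, e.lt_iff_lt]
    · intro i _ hi
      rw [hext' q i (by simpa using hi)]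
      simp

section Fin

variable {n : ℕ}

theorem isPairing_iff (π : Equiv.Perm (Fin n)) : IsPairing π ↔ PairsOn Finset.univ π :=
  ⟨fun h => ⟨by simp, fun i _ => (h i).1, fun i => (h i).2⟩,
    fun h i => ⟨h.ne i (Finset.mem_univ _), h.invol i⟩⟩

open Classical in
theorem sum_isPairing {R : Type*} [CommRing R] (Q : (Fin n → Fin n) → Prop)
    (F : (Fin n → Fin n) → R) :
    ∑ π : Equiv.Perm (Fin n) with IsPairing π ∧ Q π, F π
      = ∑ p : Fin n → Fin n with PairsOn Finset.univ p ∧ Q p, F p := by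
  refine Finset.sum_nbij (fun π => ⇑π) ?_ ?_ ?_ fun _ _ => rfl
  · intro π hπ
    simpa [isPairing_iff] using hπ
  · intro π _ π' _ h
    exact DFunLike.coe_injective h
  · intro p hp
    simp only [Finset.coe_filter, Finset.mem_univ, true_and, Set.mem_ofPred_eq] at hp
    refine ⟨Function.Involutive.toPerm p hp.1.invol, ?_, rfl⟩
    simp only [Finset.coe_filter, Finset.mem_univ, true_and, Set.mem_ofPred_eq, isPairing_iff]
    exact hp

end Fin

theorem ncSum_univ_succ {n : ℕ} {R : Type*} [CommRing R] (c : Fin (n + 1) → Fin (n + 1) → R) :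
    ncSum c Finset.univ = ∑ k : Fin n, c 0 k.succ *
      (ncSum c (Finset.univ.filter fun i => 0 < i ∧ i < k.succ) *
        ncSum c (Finset.univ.filter fun i => k.succ < i)) := by
  have huniv : (Finset.univ : Finset (Fin (n + 1))).erase 0
      = Finset.univ.map (Fin.succEmb n) := by
    ext i
    refine Fin.cases ?_ (fun j => ?_) i <;> simp [Fin.succ_ne_zero]
  rw [ncSum_eq _ _ 0 (Finset.mem_univ _) fun i _ => Fin.zero_le i, huniv, Finset.sum_map]
  rfl

/-! ### The recursion for the limit of the normalized trace -/

section AlphaList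

variable {H : Type*} [NormedAddCommGroup H] [InnerProductSpace ℝ H]

theorem alpha_eq_ncSum {n : ℕ} (f : Fin n → H) :
    alpha f = ncSum (fun i j => inner ℝ (f i) (f j)) Finset.univ := by
  classical
  rw [alpha, NC2, ncSum, ← sum_isPairing]
  refine Finset.sum_congr (by ext; simp [NonCross]) fun π _ => ?_
  rw [pairingWeight, blockProd, Finset.prod_filter]

/-- `alpha` for lists. -/
noncomputable def alphaList (w : List H) : ℝ := alpha w.get

theorem alphaList_nil : alphaList ([] : List H) = 1 := by
  rw [alphaList, alpha_eq_ncSum]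
  exact ncSum_empty _

/-- The first letter is paired with position `k` of `w`; the Catalan recursion then leaves the
subword in between and the subword after. Lists are used because these subwords are simply `take`
and `drop`. -/
theorem alphaList_cons (f : H) (w : List H) :
    alphaList (f :: w) = ∑ k : Fin w.length,
      inner ℝ f (w.get k) * (alphaList (w.take k) * alphaList (w.drop (k + 1))) := by
  rw [alphaList, alpha_eq_ncSum]
  change ncSum (α := Fin (w.length + 1)) (fun i j => inner ℝ ((f :: w).get i) ((f :: w).get j))
    Finset.univ = _
  rw [ncSum_univ_succ]
  refine Finset.sum_congr rfl fun k _ => ?_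
  have hk := k.2
  -- In `f :: w` the partner sits at position `k + 1`, so the inner subword is shifted by `1` and
  -- the outer one by `k + 2`.
  let e1 : Fin (w.take k).length ↪o Fin (w.length + 1) :=
    OrderEmbedding.ofStrictMono (fun j => ⟨j + 1, by have := j.2; simp at this; omega⟩)
      (fun i j h => by simpa using h)
  let e2 : Fin (w.drop (k + 1)).length ↪o Fin (w.length + 1) :=
    OrderEmbedding.ofStrictMono (fun j => ⟨j + k + 2, by have := j.2; simp at this; omega⟩)
      (fun i j h => by simpa using h)
  have he1 : ∀ j, ((e1 j : Fin (w.length + 1)) : ℕ) = j + 1 := fun _ => rfl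
  have he2 : ∀ j, ((e2 j : Fin (w.length + 1)) : ℕ) = j + k + 2 := fun _ => rfl
  have h1 : (Finset.univ.filter fun i : Fin (w.length + 1) => 0 < i ∧ i < k.succ)
      = Finset.univ.map e1.toEmbedding := by
    ext i
    simp only [Finset.mem_filter, Finset.mem_univ, true_and, Finset.mem_map,
      RelEmbedding.coe_toEmbedding]
    constructor
    · rintro ⟨h, h'⟩
      simp only [Fin.lt_def, Fin.val_zero, Fin.val_succ] at h h'
      refine ⟨⟨i - 1, by simp; omega⟩, ?_⟩
      ext
      rw [he1]
      simp only
      omega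
    · rintro ⟨j, rfl⟩
      have := j.2
      simp only [List.length_take] at this
      simp only [Fin.lt_def, he1, Fin.val_zero, Fin.val_succ]
      omega
  have h2 : (Finset.univ.filter fun i : Fin (w.length + 1) => k.succ < i)
      = Finset.univ.map e2.toEmbedding := by
    ext i
    simp only [Finset.mem_filter, Finset.mem_univ, true_and, Finset.mem_map,
      RelEmbedding.coe_toEmbedding]
    constructor
    · intro h
      simp only [Fin.lt_def, Fin.val_succ] at h
      refine ⟨⟨i - (k + 2), by simp; omega⟩, ?_⟩
      ext
      rw [he2]
      simp only
      omega
    · rintro ⟨j, rfl⟩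
      simp only [Fin.lt_def, he2, Fin.val_succ]
      omega
  rw [h1, h2, ncSum_map, ncSum_map, alphaList, alphaList, alpha_eq_ncSum, alpha_eq_ncSum]
  congr 2
  · congr 1
    ext i j
    have h : ∀ i, (f :: w).get (e1 i) = (w.take k).get i := fun i => by
      rw [List.get_eq_getElem, List.get_eq_getElem]
      simp only [he1, List.getElem_cons_succ, List.getElem_take]
    simp only [h]
  · congr 1
    ext i j
    have h : ∀ i, (f :: w).get (e2 i) = (w.drop (k + 1)).get i := fun i => by
      have he : ((e2 i : Fin (w.length + 1)) : ℕ) = (k + 1 + i) + 1 := by rw [he2]; omega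
      rw [List.get_eq_getElem, List.get_eq_getElem]
      simp only [he, List.getElem_cons_succ, List.getElem_drop]
    simp only [h]

end AlphaList

/-! ### Words in generic matrices and the loop equation -/

section Words

variable {H : Type*} [NormedAddCommGroup H] [InnerProductSpace ℝ H] {N : ℕ}

/-- The generic matrix with label `f`: its entries are polynomial variables. -/
noncomputable def genMat (N : ℕ) (f : H) :
    Matrix (Fin N) (Fin N) (MvPolynomial (H × Fin N × Fin N) ℂ) :=
  Matrix.of fun i j => MvPolynomial.X (f, i, j)

/-- The product of the generic matrices along a word. -/
noncomputable def wordMat (N : ℕ) (w : List H) :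
    Matrix (Fin N) (Fin N) (MvPolynomial (H × Fin N × Fin N) ℂ) :=
  (w.map (genMat N)).prod

/-- The trace of a word in the generic matrices. -/
noncomputable def wordTrace (N : ℕ) (w : List H) : MvPolynomial (H × Fin N × Fin N) ℂ :=
  (wordMat N w).trace

/-- The covariance `E[x_ij(f) x_kl(g)]` of the entries of Hermitian Gaussian matrices. -/
noncomputable def entryCov (s t : H × Fin N × Fin N) : ℂ :=
  if s.2.1 = t.2.2 ∧ s.2.2 = t.2.1 then (1 / (N : ℂ)) * ((inner ℝ s.1 t.1 : ℝ) : ℂ) else 0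

/-- Contraction of the variable `x_s` with the others. -/
noncomputable def contraction (s : H × Fin N × Fin N) :
    Derivation ℂ (MvPolynomial (H × Fin N × Fin N) ℂ) (MvPolynomial (H × Fin N × Fin N) ℂ) :=
  MvPolynomial.mkDerivation ℂ fun t => MvPolynomial.C (entryCov s t)

omit [NormedAddCommGroup H] [InnerProductSpace ℝ H] in
theorem wordMat_nil : wordMat N ([] : List H) = 1 := rfl

omit [NormedAddCommGroup H] [InnerProductSpace ℝ H] in
theorem wordMat_cons (f : H) (w : List H) : wordMat N (f :: w) = genMat N f * wordMat N w := by
  simp [wordMat]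

omit [NormedAddCommGroup H] [InnerProductSpace ℝ H] in
theorem wordMat_append (v w : List H) : wordMat N (v ++ w) = wordMat N v * wordMat N w := by
  simp [wordMat]

theorem contraction_genMat (f g : H) (i j a b : Fin N) :
    contraction (f, i, j) (genMat N g a b)
      = MvPolynomial.C ((1 / (N : ℂ)) * ((inner ℝ f g : ℝ) : ℂ)) *
        ((1 : Matrix (Fin N) (Fin N) (MvPolynomial (H × Fin N × Fin N) ℂ)) a j *
          (1 : Matrix (Fin N) (Fin N) (MvPolynomial (H × Fin N × Fin N) ℂ)) i b) := by
  simp only [contraction, genMat, Matrix.of_apply, MvPolynomial.mkDerivation_X, entryCov,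
    Matrix.one_apply]
  by_cases h1 : i = b <;> by_cases h2 : j = a <;> simp [h1, h2, Ne.symm]

/-- Leibniz' rule contracts each letter in turn. The two Kronecker deltas of the contracted entry
cut the word at that letter, closing the prefix with index `j` and opening the suffix with index
`i`. -/
theorem contraction_wordMat (f : H) (i j : Fin N) (w : List H) (a b : Fin N) :
    contraction (f, i, j) (wordMat N w a b)
      = ∑ k : Fin w.length, MvPolynomial.C ((1 / (N : ℂ)) * ((inner ℝ f (w.get k) : ℝ) : ℂ)) *
        (wordMat N (w.take k) a j * wordMat N (w.drop (k + 1)) i b) := by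
  induction w generalizing a b with
  | nil =>
    rw [wordMat_nil, Matrix.one_apply]
    split_ifs <;> simp
  | cons g w ih =>
    rw [wordMat_cons, Matrix.mul_apply, map_sum]
    simp only [Derivation.leibniz, smul_eq_mul, ih, contraction_genMat, Finset.sum_add_distrib]
    change _ = ∑ k : Fin (w.length + 1), _
    rw [Fin.sum_univ_succ, add_comm]
    congr 1
    · simp only [Fin.val_zero, List.take_zero, zero_add, List.drop_one, List.tail_cons,
        wordMat_nil, Matrix.one_apply]
      simp
      ring_nf
    · simp only [Finset.mul_sum]
      rw [Finset.sum_comm]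
      refine Finset.sum_congr rfl fun k _ => ?_
      simp only [Fin.val_succ, List.take_succ_cons, List.drop_succ_cons, wordMat_cons,
        Matrix.mul_apply, Finset.sum_mul, Finset.mul_sum]
      refine Finset.sum_congr rfl fun e _ => ?_
      simp
      ring

/-- Contraction within one trace: after summation over the cut indices, prefix and suffix close up
separately and the trace splits. -/
theorem sum_contraction_wordMat (f : H) (w : List H) :
    ∑ i, ∑ j, contraction (f, i, j) (wordMat N w j i)
      = ∑ k : Fin w.length, MvPolynomial.C ((1 / (N : ℂ)) * ((inner ℝ f (w.get k) : ℝ) : ℂ)) *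
        (wordTrace N (w.take k) * wordTrace N (w.drop (k + 1))) := by
  simp only [contraction_wordMat]
  rw [Finset.sum_congr rfl fun i _ => Finset.sum_comm, Finset.sum_comm]
  refine Finset.sum_congr rfl fun k _ => ?_
  simp only [wordTrace, Matrix.trace, Matrix.diag_apply, Finset.sum_mul, Finset.mul_sum]

/-- Contraction between two traces: the cut indices glue `w` to the second word opened at its `k`-th
letter, and one trace results. -/
theorem sum_wordMat_mul_contraction (f : H) (w v : List H) :
    ∑ i, ∑ j, wordMat N w j i * contraction (f, i, j) (wordTrace N v)
      = ∑ k : Fin v.length, MvPolynomial.C ((1 / (N : ℂ)) * ((inner ℝ f (v.get k) : ℝ) : ℂ)) *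
        wordTrace N (w ++ v.drop (k + 1) ++ v.take k) := by
  simp only [wordTrace, Matrix.trace, Matrix.diag_apply, map_sum, contraction_wordMat,
    wordMat_append, Matrix.mul_apply, Finset.mul_sum, Finset.sum_mul]
  simp_rw [Finset.sum_comm (s := (Finset.univ : Finset (Fin N)))
    (t := (Finset.univ : Finset (Fin v.length)))]
  refine Finset.sum_congr rfl fun k _ => ?_
  rw [Finset.sum_comm]
  refine Finset.sum_congr rfl fun j _ => ?_
  rw [Finset.sum_comm]
  refine Finset.sum_congr rfl fun a _ => Finset.sum_congr rfl fun i _ => ?_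
  ring

theorem derivation_list_prod {A ι : Type*} [CommRing A] [Algebra ℂ A] (D : Derivation ℂ A A)
    (F : ι → A) (L : List ι) :
    D (L.map F).prod
      = ∑ k : Fin L.length, ((L.eraseIdx k).map F).prod * D (F (L.get k)) := by
  induction L with
  | nil => simp
  | cons a L ih =>
    change _ = ∑ k : Fin (L.length + 1), _
    rw [Fin.sum_univ_succ, List.map_cons, List.prod_cons, D.leibniz, ih, add_comm]
    simp [Finset.mul_sum, mul_assoc]

/-- The expectation functional of a Hermitian Gaussian family, characterized by Gaussian
integration by parts. -/
structure IsWick (φ : MvPolynomial (H × Fin N × Fin N) ℂ →ₗ[ℂ] ℂ) : Prop where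
  map_one : φ 1 = 1
  map_X_mul : ∀ s p, φ (MvPolynomial.X s * p) = φ (contraction s p)

/-- The fluctuation of the trace of a word in the generic matrices. -/
noncomputable def wordFluct (N : ℕ) (w : List H) : MvPolynomial (H × Fin N × Fin N) ℂ :=
  wordTrace N w - MvPolynomial.C ((N : ℂ) * ((alphaList w : ℝ) : ℂ))

theorem wordFluct_nil : wordFluct N ([] : List H) = 0 := by
  simp [wordFluct, wordTrace, wordMat_nil, alphaList_nil]

/-- The mixed moment of fluctuations. -/
noncomputable def fluctMoment (φ : MvPolynomial (H × Fin N × Fin N) ℂ →ₗ[ℂ] ℂ)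
    (L : List (List H)) : ℂ := φ (L.map (wordFluct N)).prod

variable {φ : MvPolynomial (H × Fin N × Fin N) ℂ →ₗ[ℂ] ℂ}

/-- Expanding the trace exposes the first letter as a linear factor `x_ij(f)`. Integration by parts
then contracts it either inside its own trace or with `q`. -/
theorem IsWick.wordTrace_cons_mul (hφ : IsWick φ) (f : H) (w : List H)
    (q : MvPolynomial (H × Fin N × Fin N) ℂ) :
    φ (wordTrace N (f :: w) * q)
      = φ ((∑ i, ∑ j, contraction (f, i, j) (wordMat N w j i)) * q
        + ∑ i, ∑ j, wordMat N w j i * contraction (f, i, j) q) := by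
  have h1 : wordTrace N (f :: w) * q
      = ∑ i, ∑ j, MvPolynomial.X (f, i, j) * (wordMat N w j i * q) := by
    simp only [wordTrace, wordMat_cons, Matrix.trace, Matrix.diag_apply, Matrix.mul_apply,
      Finset.sum_mul, genMat, Matrix.of_apply, mul_assoc]
  rw [h1]
  simp only [map_sum, hφ.map_X_mul, Derivation.leibniz, smul_eq_mul, Finset.sum_mul, map_add,
    Finset.sum_add_distrib]
  rw [add_comm]
  simp only [mul_comm q]

/-- The loop equation: substitute trace = fluctuation + `N α` into the split and merge terms. The
order-`N` contributions of the splits sum to the centering constant of `f :: w` and cancel;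
everything left is of order one or carries an explicit `N⁻¹`. -/
theorem IsWick.fluctMoment_cons (hφ : IsWick φ) (hN : N ≠ 0) (f : H) (w : List H)
    (L : List (List H)) :
    fluctMoment φ ((f :: w) :: L)
      = ∑ k : Fin w.length, ((inner ℝ f (w.get k) : ℝ) : ℂ) *
          ((N : ℂ)⁻¹ * fluctMoment φ (w.take k :: w.drop (k + 1) :: L)
            + (alphaList (w.take k) : ℂ) * fluctMoment φ (w.drop (k + 1) :: L)
            + (alphaList (w.drop (k + 1)) : ℂ) * fluctMoment φ (w.take k :: L))
        + ∑ j : Fin L.length, ∑ k : Fin (L.get j).length,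
          ((inner ℝ f ((L.get j).get k) : ℝ) : ℂ) *
          ((N : ℂ)⁻¹ * fluctMoment φ
              ((w ++ (L.get j).drop (k + 1) ++ (L.get j).take k) :: L.eraseIdx j)
            + (alphaList (w ++ (L.get j).drop (k + 1) ++ (L.get j).take k) : ℂ) *
              fluctMoment φ (L.eraseIdx j)) := by
  have hN' : (N : ℂ) ≠ 0 := by exact_mod_cast hN
  have hC : ∀ (c : ℂ) p, φ (MvPolynomial.C c * p) = c * φ p := fun c p => by
    rw [← MvPolynomial.smul_eq_C_mul, map_smul, smul_eq_mul]
  have htr : ∀ v : List H, wordTrace N v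
      = wordFluct N v + MvPolynomial.C ((N : ℂ) * ((alphaList v : ℝ) : ℂ)) := fun v => by
    simp [wordFluct]
  have hcf : ∀ i j (v : List H), contraction (f, i, j) (wordFluct N v)
      = contraction (f, i, j) (wordTrace N v) := fun i j v => by
    simp [wordFluct, contraction]
  set q := (L.map (wordFluct N)).prod with hq
  have hsecond : ∑ i, ∑ j, wordMat N w j i * contraction (f, i, j) q
      = ∑ j : Fin L.length, ((L.eraseIdx j).map (wordFluct N)).prod *
        ∑ k : Fin (L.get j).length,
          MvPolynomial.C ((1 / (N : ℂ)) * ((inner ℝ f ((L.get j).get k) : ℝ) : ℂ)) *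
          wordTrace N (w ++ (L.get j).drop (k + 1) ++ (L.get j).take k) := by
    simp only [← sum_wordMat_mul_contraction, hq, derivation_list_prod, hcf, Finset.mul_sum]
    rw [Finset.sum_congr rfl fun i _ => Finset.sum_comm, Finset.sum_comm]
    refine Finset.sum_congr rfl fun m _ => Finset.sum_congr rfl fun i _ =>
      Finset.sum_congr rfl fun j _ => ?_
    ring
  have hmain : fluctMoment φ ((f :: w) :: L)
      = φ (wordTrace N (f :: w) * q) - (N * (alphaList (f :: w) : ℂ)) * φ q := by
    rw [fluctMoment, List.map_cons, List.prod_cons, wordFluct, sub_mul, map_sub, hC]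
  rw [hmain, hφ.wordTrace_cons_mul, sum_contraction_wordMat, hsecond, map_add, add_sub_right_comm]
  congr 1
  · rw [Finset.sum_mul, map_sum, alphaList_cons]
    push_cast
    rw [Finset.mul_sum, Finset.sum_mul, ← Finset.sum_sub_distrib]
    refine Finset.sum_congr rfl fun k _ => ?_
    rw [mul_assoc, hC, htr, htr]
    -- Of the four products, the one with both constants, divided by `N`, is `N * a * b` and is
    -- cancelled by the recursion for `alphaList`.
    have hexp : ∀ (A B : MvPolynomial (H × Fin N × Fin N) ℂ) (a b : ℂ),
        φ ((A + MvPolynomial.C (N * a)) * (B + MvPolynomial.C (N * b)) * q)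
        = φ (A * (B * q)) + N * a * φ (B * q) + N * b * φ (A * q) + N * a * (N * b) * φ q := by
      intro A B a b
      rw [← hC, ← hC, ← hC, ← map_add, ← map_add, ← map_add]
      congr 1
      rw [MvPolynomial.C_mul (a := (N : ℂ) * a)]
      ring
    rw [hexp]
    simp only [fluctMoment, List.map_cons, List.prod_cons, ← hq]
    field_simp
    ring
  · rw [map_sum]
    refine Finset.sum_congr rfl fun j _ => ?_
    rw [Finset.mul_sum, map_sum]
    refine Finset.sum_congr rfl fun k _ => ?_
    rw [mul_left_comm, hC, htr, mul_add, map_add, mul_comm _ (MvPolynomial.C _), hC]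
    simp only [fluctMoment, List.map_cons, List.prod_cons]
    rw [mul_comm (List.prod _)]
    field_simp

end Words

/-! ### Convergence of mixed moments to Wick sums -/

section Limit

variable {H : Type*} [NormedAddCommGroup H] [InnerProductSpace ℝ H]

/-- The limit covariance of the fluctuations, defined by the loop equation. -/
noncomputable def covList : List H → List H → ℝ
  | [], _ => 0
  | f :: w, g =>
      ∑ k : Fin w.length, inner ℝ f (w.get k) *
        (alphaList (w.take k) * covList (w.drop (k + 1)) g
          + alphaList (w.drop (k + 1)) * covList (w.take k) g)
      + ∑ k : Fin g.length, inner ℝ f (g.get k) * alphaList (w ++ g.drop (k + 1) ++ g.take k)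
  termination_by w _ => w.length
  decreasing_by
    all_goals simp

/-- The mixed moments of a centered Gaussian family with covariance `covList`. -/
noncomputable def wickSum : List (List H) → ℝ
  | [] => 1
  | w :: L => ∑ j : Fin L.length, covList w (L.get j) * wickSum (L.eraseIdx j)
  termination_by L => L.length
  decreasing_by
    rw [List.length_eraseIdx_of_lt j.2, List.length_cons]
    omega

theorem covList_nil (g : List H) : covList [] g = 0 := by
  rw [covList]

theorem wickSum_nil : wickSum ([] : List (List H)) = 1 := by
  rw [wickSum]

theorem wickSum_cons (w : List H) (L : List (List H)) :
    wickSum (w :: L) = ∑ j : Fin L.length, covList w (L.get j) * wickSum (L.eraseIdx j) := by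
  rw [wickSum]

/-- This is the loop equation with its `N⁻¹` terms dropped. The splits are the linear part of the
recursion of `covList` in its first argument, the merges its inhomogeneous part. -/
theorem wickSum_cons_cons (f : H) (w : List H) (L : List (List H)) :
    wickSum ((f :: w) :: L)
      = ∑ k : Fin w.length, inner ℝ f (w.get k) *
          (alphaList (w.take k) * wickSum (w.drop (k + 1) :: L)
            + alphaList (w.drop (k + 1)) * wickSum (w.take k :: L))
        + ∑ j : Fin L.length, ∑ k : Fin (L.get j).length, inner ℝ f ((L.get j).get k) *
          (alphaList (w ++ (L.get j).drop (k + 1) ++ (L.get j).take k) *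
            wickSum (L.eraseIdx j)) := by
  simp only [wickSum_cons, covList, add_mul, Finset.sum_add_distrib, Finset.sum_mul,
    Finset.mul_sum, mul_add]
  congr 1
  · congr 1
    · rw [Finset.sum_comm]
      refine Finset.sum_congr rfl fun k _ => Finset.sum_congr rfl fun j _ => by ring
    · rw [Finset.sum_comm]
      refine Finset.sum_congr rfl fun k _ => Finset.sum_congr rfl fun j _ => by ring
  · refine Finset.sum_congr rfl fun k _ => Finset.sum_congr rfl fun j _ => by ring

theorem sum_length_eraseIdx {α : Type*} (L : List (List α)) (j : Fin L.length) :
    ((L.eraseIdx j).map List.length).sum + (L.get j).length = (L.map List.length).sum := by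
  induction L with
  | nil => exact j.elim0
  | cons a L ih =>
    refine Fin.cases ?_ (fun j => ?_) j
    · simp [add_comm]
    · have := ih j
      have h2 : (a :: L).get j.succ = L.get j := rfl
      rw [h2]
      simp only [Fin.val_succ, List.eraseIdx_cons_succ, List.map_cons, List.sum_cons]
      omega

/-- The induction is on the total number of letters, not of words: a split increases the number of
words, but every contraction removes at least the two contracted letters. The `N⁻¹` terms multiply
convergent moments and vanish. -/
theorem tendsto_fluctMoment {φ : ∀ N, MvPolynomial (H × Fin N × Fin N) ℂ →ₗ[ℂ] ℂ}
    (hφ : ∀ N, IsWick (φ N)) (L : List (List H)) :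
    Tendsto (fun N => fluctMoment (φ N) L) atTop (𝓝 (wickSum L : ℂ)) := by
  induction hn : (L.map List.length).sum using Nat.strong_induction_on generalizing L with
  | _ n ih =>
  match L with
  | [] => simp [fluctMoment, (hφ _).map_one, wickSum_nil]
  | [] :: L => simp [fluctMoment, wordFluct_nil, wickSum_cons, covList_nil]
  | (f :: w) :: L =>
    have hn' : w.length + 1 + (L.map List.length).sum = n := by simpa using hn
    have hinv : Tendsto (fun N : ℕ => (N : ℂ)⁻¹) atTop (𝓝 0) :=
      tendsto_inv_atTop_nhds_zero_nat
    rw [tendsto_congr' (by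
      filter_upwards [eventually_ne_atTop 0] with N hN
      exact (hφ N).fluctMoment_cons hN f w L), wickSum_cons_cons]
    push_cast
    refine Tendsto.add (tendsto_finsetSum _ fun k _ => ?_)
      (tendsto_finsetSum _ fun j _ => tendsto_finsetSum _ fun k _ => ?_)
    · have hk := k.2
      have t1 := ih _ (by simp; omega) (w.take k :: w.drop (k + 1) :: L) rfl
      have t2 := ih _ (by simp; omega) (w.drop (k + 1) :: L) rfl
      have t3 := ih _ (by simp; omega) (w.take k :: L) rfl
      have := (((hinv.mul t1).add (t2.const_mul (alphaList (w.take k) : ℂ))).add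
        (t3.const_mul (alphaList (w.drop (k + 1)) : ℂ))).const_mul
          ((inner ℝ f (w.get k) : ℝ) : ℂ)
      simpa using this
    · have hk := k.2
      have hl := sum_length_eraseIdx L j
      have t1 := ih _ (by simp at *; omega)
        ((w ++ (L.get j).drop (k + 1) ++ (L.get j).take k) :: L.eraseIdx j) rfl
      have t2 := ih _ (by simp at *; omega) (L.eraseIdx j) rfl
      have := ((hinv.mul t1).add (t2.const_mul
        (alphaList (w ++ (L.get j).drop (k + 1) ++ (L.get j).take k) : ℂ))).const_mul
          ((inner ℝ f ((L.get j).get k) : ℝ) : ℂ)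
      simpa using this

end Limit

/-! ### Cycle counts and permutations of two circles -/

section Cycles

/-- The number of labellings by `Fin N` that are invariant under `σ`. -/
noncomputable def invariantCount {k : ℕ} (N : ℕ) (σ : Equiv.Perm (Fin k)) : ℕ :=
  Nat.card {i : Fin k → Fin N // ∀ j, i j = i (σ j)}

/-- An invariant labelling is constant on cycles, so it is a free choice of one label per cycle. -/
theorem invariantCount_eq_pow {k : ℕ} (N : ℕ) (σ : Equiv.Perm (Fin k)) :
    invariantCount N σ = N ^ numCycles σ := by
  classical
  have hz : ∀ i : Fin k → Fin N, (∀ j, i j = i (σ j)) →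
      ∀ a b, (Equiv.Perm.SameCycle.setoid σ) a b → i a = i b := by
    rintro i hi a b ⟨n, rfl⟩
    have hinv : ∀ j, i j = i (σ⁻¹ j) := fun j => by
      have := hi (σ⁻¹ j)
      simpa using this.symm
    induction n using Int.induction_on with
    | zero => simp
    | succ n ih => rw [ih, add_comm, zpow_add, zpow_one, Equiv.Perm.mul_apply, ← hi]
    | pred n ih =>
      rw [ih, sub_eq_add_neg, add_comm, zpow_add, zpow_neg_one, Equiv.Perm.mul_apply, ← hinv]
  let e : {i : Fin k → Fin N // ∀ j, i j = i (σ j)} ≃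
      (Quotient (Equiv.Perm.SameCycle.setoid σ) → Fin N) :=
    { toFun := fun i => Quotient.lift i.1 (hz i.1 i.2)
      invFun := fun q => ⟨fun j => q (Quotient.mk _ j), fun j => by
        exact congrArg q (Quotient.sound ⟨1, by simp⟩)⟩
      left_inv := fun i => rfl
      right_inv := fun q => by
        ext x
        induction x using Quotient.inductionOn
        rfl }
  rw [invariantCount, Nat.card_congr e, Nat.card_fun]
  simp [numCycles]

/-- The permutation of `Fin (n + m)` acting as `σ` on the first `n` and as `τ` on the last `m`
points. -/
def blockPerm {n m : ℕ} (σ : Equiv.Perm (Fin n)) (τ : Equiv.Perm (Fin m)) :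
    Equiv.Perm (Fin (n + m)) :=
  finSumFinEquiv.permCongr (Equiv.sumCongr σ τ)

variable {n m : ℕ}

theorem blockPerm_castAdd (σ : Equiv.Perm (Fin n)) (τ : Equiv.Perm (Fin m)) (i : Fin n) :
    blockPerm σ τ (Fin.castAdd m i) = Fin.castAdd m (σ i) := by
  simp [blockPerm, Equiv.permCongr_apply]

theorem blockPerm_natAdd (σ : Equiv.Perm (Fin n)) (τ : Equiv.Perm (Fin m)) (i : Fin m) :
    blockPerm σ τ (Fin.natAdd n i) = Fin.natAdd n (τ i) := by
  simp [blockPerm, Equiv.permCongr_apply]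

theorem blockPerm_mul (σ σ' : Equiv.Perm (Fin n)) (τ τ' : Equiv.Perm (Fin m)) :
    blockPerm σ τ * blockPerm σ' τ' = blockPerm (σ * σ') (τ * τ') := by
  ext i
  refine Fin.addCases (fun i => ?_) (fun i => ?_) i <;>
    simp [Equiv.Perm.mul_apply, blockPerm_castAdd, blockPerm_natAdd]

theorem forall_fin_add {Q : Fin (n + m) → Prop} :
    (∀ i, Q i) ↔ (∀ i, Q (Fin.castAdd m i)) ∧ ∀ i, Q (Fin.natAdd n i) :=
  ⟨fun h => ⟨fun _ => h _, fun _ => h _⟩, fun h i => Fin.addCases h.1 h.2 i⟩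

theorem invariantCount_blockPerm (N : ℕ) (σ : Equiv.Perm (Fin n)) (τ : Equiv.Perm (Fin m)) :
    invariantCount N (blockPerm σ τ) = invariantCount N σ * invariantCount N τ := by
  rw [invariantCount, invariantCount, invariantCount, ← Nat.card_prod]
  refine Nat.card_congr ⟨fun i => (⟨fun j => i.1 (Fin.castAdd m j), fun j => ?_⟩,
    ⟨fun j => i.1 (Fin.natAdd n j), fun j => ?_⟩),
    fun p => ⟨Fin.append p.1.1 p.2.1, ?_⟩, fun i => ?_, fun p => ?_⟩
  · exact (i.2 _).trans (by rw [blockPerm_castAdd])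
  · exact (i.2 _).trans (by rw [blockPerm_natAdd])
  · rw [forall_fin_add]
    refine ⟨fun j => ?_, fun j => ?_⟩
    · rw [blockPerm_castAdd, Fin.append_left, Fin.append_left, p.1.2]
    · rw [blockPerm_natAdd, Fin.append_right, Fin.append_right, p.2.2]
  · apply Subtype.ext
    ext j
    refine Fin.addCases (fun j => ?_) (fun j => ?_) j <;> simp
  · apply Prod.ext <;> apply Subtype.ext <;> ext j <;> simp

theorem isPairing_blockPerm (σ : Equiv.Perm (Fin n)) (τ : Equiv.Perm (Fin m)) :
    IsPairing (blockPerm σ τ) ↔ IsPairing σ ∧ IsPairing τ := by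
  unfold IsPairing
  rw [forall_fin_add]
  simp [blockPerm_castAdd, blockPerm_natAdd, Fin.castAdd_inj, Fin.natAdd_inj]

/-- If nothing leaves the first circle, finiteness forces the permutation to preserve both circles.
-/
theorem exists_blockPerm {π : Equiv.Perm (Fin (n + m))}
    (h : ¬ ∃ (i : Fin n) (j : Fin m), π (Fin.castAdd m i) = Fin.natAdd n j) :
    ∃ σ τ, blockPerm σ τ = π := by
  have hm : Set.MapsTo (finSumFinEquiv.symm.permCongr π) (Set.range Sum.inl)
      (Set.range (Sum.inl : Fin n → Fin n ⊕ Fin m)) := by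
    rintro _ ⟨i, rfl⟩
    simp only [Equiv.permCongr_apply, Equiv.symm_symm, finSumFinEquiv_apply_left]
    rcases hs : finSumFinEquiv.symm (π (Fin.castAdd m i)) with a | b
    · exact ⟨a, rfl⟩
    · refine absurd ⟨i, b, ?_⟩ h
      rw [Equiv.symm_apply_eq] at hs
      simpa using hs
  obtain ⟨⟨σ, τ⟩, hστ⟩ := Equiv.Perm.mem_sumCongrHom_range_of_perm_mapsTo_inl hm
  refine ⟨σ, τ, ?_⟩
  change Equiv.sumCongr σ τ = _ at hστ
  rw [blockPerm, hστ]
  ext i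
  simp [Equiv.permCongr_apply]

theorem blockPerm_injective :
    Function.Injective fun p : Equiv.Perm (Fin n) × Equiv.Perm (Fin m) => blockPerm p.1 p.2 := by
  rintro ⟨σ, τ⟩ ⟨σ', τ'⟩ h
  have h : blockPerm σ τ = blockPerm σ' τ' := h
  apply Prod.ext <;> ext i
  · have := congrArg (fun p => p (Fin.castAdd m i)) h
    simp only [blockPerm_castAdd, Fin.castAdd_inj] at this
    simp [this]
  · have := congrArg (fun p => p (Fin.natAdd n i)) h
    simp only [blockPerm_natAdd, Fin.natAdd_inj] at this
    simp [this]

/-- A pairing exchanges the smaller and the larger element of each block, so exactly half of the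
points are the smaller ones. -/
theorem two_mul_card_lt {k : ℕ} {π : Equiv.Perm (Fin k)} (hπ : IsPairing π) :
    2 * (Finset.univ.filter fun i => i < π i).card = k := by
  have h1 : (Finset.univ.filter fun i => i < π i).card
      = (Finset.univ.filter fun i => π i < i).card := by
    refine Finset.card_bij (fun i _ => π i) ?_ ?_ ?_
    · intro i hi
      simpa [(hπ i).2] using hi
    · intro i _ j _ h
      exact π.injective h
    · intro i hi
      exact ⟨π i, by simpa [(hπ i).2] using hi, (hπ i).2⟩
  have h2 : (Finset.univ.filter fun i => π i < i) = Finset.univ.filter fun i => ¬ i < π i := by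
    ext i
    have := (hπ i).1
    simp only [Finset.mem_filter, Finset.mem_univ, true_and, not_lt]
    exact ⟨le_of_lt, fun h => lt_of_le_of_ne h this⟩
  have h3 := Finset.card_filter_add_card_filter_not (s := (Finset.univ : Finset (Fin k)))
    (fun i => i < π i)
  rw [← h2, ← h1, Finset.card_univ, Fintype.card_fin] at h3
  omega

variable {H : Type*} [NormedAddCommGroup H] [InnerProductSpace ℝ H]

theorem pairingWeight_blockPerm (f : Fin n → H) (g : Fin m → H) (σ : Equiv.Perm (Fin n))
    (τ : Equiv.Perm (Fin m)) :
    pairingWeight (Fin.append f g) (blockPerm σ τ) = pairingWeight f σ * pairingWeight g τ := by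
  simp only [pairingWeight, Finset.prod_filter]
  rw [Fin.prod_univ_add]
  have hlt : ∀ a b : Fin n, Fin.castAdd m a < Fin.castAdd m b ↔ a < b := fun _ _ => Iff.rfl
  simp [blockPerm_castAdd, blockPerm_natAdd, hlt]

end Cycles

/-! ### The genus expansion -/

section Genus

variable {H : Type*} [NormedAddCommGroup H] [InnerProductSpace ℝ H] {N : ℕ}
  {φ : MvPolynomial (H × Fin N × Fin N) ℂ →ₗ[ℂ] ℂ}

/-- Integrating by parts in the factor of smallest index is the recursion `pairSum_eq`, which
iterates to the full sum over pairings. -/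
theorem IsWick.map_prod_X {k : ℕ} (hφ : IsWick φ) (t : Fin k → H × Fin N × Fin N)
    (S : Finset (Fin k)) :
    φ (∏ j ∈ S, MvPolynomial.X (t j)) = pairSum (fun i j => entryCov (t i) (t j)) S := by
  induction hn : S.card using Nat.strong_induction_on generalizing S with
  | _ n ih =>
  rcases S.eq_empty_or_nonempty with rfl | hS
  · rw [pairSum_empty, Finset.prod_empty, hφ.map_one]
  have ha := S.min'_mem hS
  rw [pairSum_eq _ S (S.min' hS) ha fun i hi => S.min'_le i hi,
    ← Finset.mul_prod_erase S _ ha, hφ.map_X_mul, derivation_prod, map_sum]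
  refine Finset.sum_congr rfl fun j hj => ?_
  rw [contraction, MvPolynomial.mkDerivation_X, mul_comm, ← MvPolynomial.smul_eq_C_mul, map_smul,
    smul_eq_mul, ih _ _ _ rfl]
  rw [← hn]
  exact Finset.card_lt_card ((Finset.erase_ssubset hj).trans (Finset.erase_ssubset ha))

/-- The sum over all labellings of the products of entries along the cycles of `σ`. -/
noncomputable def cycleProduct {k : ℕ} (N : ℕ) (σ : Equiv.Perm (Fin k)) (h : Fin k → H) :
    MvPolynomial (H × Fin N × Fin N) ℂ :=
  ∑ i : Fin k → Fin N, ∏ j, MvPolynomial.X (h j, i j, i (σ j))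

open Classical in
/-- **Genus expansion.** -/
theorem IsWick.map_cycleProduct {k : ℕ} (hφ : IsWick φ) (σ : Equiv.Perm (Fin k)) (h : Fin k → H) :
    φ (cycleProduct N σ h)
      = ∑ π : Equiv.Perm (Fin k) with IsPairing π, (pairingWeight h π : ℂ) *
        ((N : ℂ)⁻¹ ^ (Finset.univ.filter fun i => i < π i).card * invariantCount N (σ * π)) := by
  have h1 : ∀ i : Fin k → Fin N, φ (∏ j, MvPolynomial.X (h j, i j, i (σ j)))
      = ∑ π : Equiv.Perm (Fin k) with IsPairing π,
        if ∀ j, i j = i (σ (π j)) then (pairingWeight h π : ℂ) *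
          (N : ℂ)⁻¹ ^ (Finset.univ.filter fun i => i < π i).card else 0 := by
    intro i
    rw [hφ.map_prod_X (fun j => (h j, i j, i (σ j))), pairSum]
    have := sum_isPairing (fun _ => True) (blockProd (fun a b : Fin k =>
      entryCov (h a, i a, i (σ a)) (h b, i b, i (σ b))))
    simp only [and_true] at this
    rw [← this]
    refine Finset.sum_congr rfl fun π hπ => ?_
    have hπ : IsPairing π := (Finset.mem_filter.1 hπ).2
    rw [blockProd, ← Finset.prod_filter]
    simp only [entryCov]
    rw [Finset.prod_ite_zero]
    -- A block `{j, π j}` imposes two index identities, one for each of its elements. Over all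
    -- blocks together they say that the labelling is invariant under `σ * π`.
    by_cases hP : ∀ j, i j = i (σ (π j))
    swap
    · rw [if_neg hP, if_neg]
      refine fun hj => hP fun j => ?_
      rcases lt_or_gt_of_ne (hπ j).1 with hlt | hlt
      · have := (hj (π j) (by simpa [(hπ j).2] using hlt)).2
        rw [(hπ j).2] at this
        exact this.symm
      · exact (hj j (by simpa using hlt)).1
    rw [if_pos hP, if_pos]
    swap
    · refine fun j _ => ⟨hP j, ?_⟩
      have := hP (π j)
      rw [(hπ j).2] at this
      exact this.symm
    rw [Finset.prod_mul_distrib, Finset.prod_const, pairingWeight, one_div, mul_comm]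
    push_cast
    rfl
  rw [cycleProduct, map_sum]
  simp_rw [h1]
  rw [Finset.sum_comm]
  refine Finset.sum_congr rfl fun π _ => ?_
  rw [Finset.sum_ite, Finset.sum_const_zero, add_zero, Finset.sum_const, nsmul_eq_mul, mul_comm,
    mul_assoc]
  congr 3
  rw [invariantCount, Nat.card_eq_fintype_card, Fintype.card_subtype]
  rfl

/-- A sum over paths from `a` to `b` with free intermediate indices: `Fin.cons a i` lists the row
indices and `Fin.snoc i b` the column indices. -/
theorem list_prod_apply {A : Type*} [CommRing A] {n : ℕ}
    (M : Fin (n + 1) → Matrix (Fin N) (Fin N) A) (a b : Fin N) :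
    (List.ofFn M).prod a b
      = ∑ i : Fin n → Fin N, ∏ k, M k ((Fin.cons a i : Fin (n + 1) → Fin N) k)
          ((Fin.snoc i b : Fin (n + 1) → Fin N) k) := by
  induction n generalizing a with
  | zero => simp [Fin.snoc]
  | succ n ih =>
    rw [List.ofFn_succ, List.prod_cons, Matrix.mul_apply, ← (Fin.consEquiv fun _ => Fin N).sum_comp,
      Fintype.sum_prod_type]
    refine Finset.sum_congr rfl fun c _ => ?_
    rw [ih, Finset.mul_sum]
    refine Finset.sum_congr rfl fun i _ => ?_
    have hs : ∀ k, (Fin.snoc (Fin.cons c i : Fin (n + 1) → Fin N) b : Fin (n + 2) → Fin N) k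
        = (Fin.cons c (Fin.snoc i b : Fin (n + 1) → Fin N) : Fin (n + 2) → Fin N) k := fun k => by
      rw [Fin.cons_snoc_eq_snoc_cons]
    rw [Fin.prod_univ_succ (n := n + 1)]
    refine congrArg₂ (· * ·) ?_ (Finset.prod_congr rfl fun k _ => ?_)
    · change _ = M 0 _ ((Fin.snoc (Fin.cons c i : Fin (n + 1) → Fin N) b : Fin (n + 2) → Fin N) 0)
      rw [hs]
      rfl
    · change _ = M k.succ _
        ((Fin.snoc (Fin.cons c i : Fin (n + 1) → Fin N) b : Fin (n + 2) → Fin N) k.succ)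
      rw [hs]
      rfl

omit [NormedAddCommGroup H] [InnerProductSpace ℝ H] in
theorem wordTrace_ofFn {n : ℕ} (f : Fin (n + 1) → H) :
    wordTrace N (List.ofFn f) = cycleProduct N (finRotate (n + 1)) f := by
  have hw : wordMat N (List.ofFn f) = (List.ofFn fun k => genMat N (f k)).prod := by
    rw [wordMat, List.map_ofFn]
    rfl
  rw [wordTrace, hw, cycleProduct, Matrix.trace, ← (Fin.consEquiv fun _ => Fin N).sum_comp,
    Fintype.sum_prod_type]
  refine Finset.sum_congr rfl fun a _ => ?_
  rw [Matrix.diag_apply, list_prod_apply]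
  refine Finset.sum_congr rfl fun i _ => Finset.prod_congr rfl fun k _ => ?_
  -- For a closed path the column indices are the row indices rotated by one place.
  have hs : (Fin.snoc i a : Fin (n + 1) → Fin N) k
      = (Fin.cons a i : Fin (n + 1) → Fin N) (finRotate (n + 1) k) := by
    refine Fin.lastCases ?_ (fun j => ?_) k
    · simp
    · rw [Fin.snoc_castSucc, finRotate_apply, Fin.coeSucc_eq_succ, Fin.cons_succ]
  rw [hs]
  rfl

omit [NormedAddCommGroup H] [InnerProductSpace ℝ H] in
theorem cycleProduct_mul {n m : ℕ} (σ : Equiv.Perm (Fin n)) (τ : Equiv.Perm (Fin m))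
    (f : Fin n → H) (g : Fin m → H) :
    cycleProduct N σ f * cycleProduct N τ g
      = cycleProduct N (blockPerm σ τ) (Fin.append f g) := by
  rw [cycleProduct, cycleProduct, cycleProduct, Finset.sum_mul_sum, ← Finset.sum_product',
    ← (Fin.appendEquiv n m).sum_comp]
  refine Finset.sum_congr rfl fun i _ => ?_
  rw [Fin.prod_univ_add]
  simp [blockPerm_castAdd, blockPerm_natAdd, Fin.appendEquiv]

open Classical in
/-- The covariance of two traces is the sum over the pairings that connect the two circles. -/
theorem IsWick.map_mul_sub {n m : ℕ} (hφ : IsWick φ) (σ : Equiv.Perm (Fin n))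
    (τ : Equiv.Perm (Fin m)) (f : Fin n → H) (g : Fin m → H) :
    φ (cycleProduct N σ f * cycleProduct N τ g)
        - φ (cycleProduct N σ f) * φ (cycleProduct N τ g)
      = ∑ π : Equiv.Perm (Fin (n + m)) with IsPairing π ∧
          ∃ (i : Fin n) (j : Fin m), π (Fin.castAdd m i) = Fin.natAdd n j,
        (pairingWeight (Fin.append f g) π : ℂ) *
        ((N : ℂ)⁻¹ ^ (Finset.univ.filter fun i => i < π i).card *
          invariantCount N (blockPerm σ τ * π)) := by
  rw [cycleProduct_mul, hφ.map_cycleProduct, hφ.map_cycleProduct, hφ.map_cycleProduct,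
    Finset.sum_mul_sum, ← Finset.sum_product', sub_eq_iff_eq_add,
    ← Finset.sum_filter_add_sum_filter_not _
      (fun π => ∃ (i : Fin n) (j : Fin m), π (Fin.castAdd m i) = Fin.natAdd n j),
    Finset.filter_filter, Finset.filter_filter]
  congr 1
  symm
  -- The pairings that do not connect the circles are pairs of pairings, with multiplicative weights
  -- and cycle counts, and reproduce the product of the expectations.
  refine Finset.sum_bij (fun p _ => blockPerm p.1 p.2) ?_ ?_ ?_ ?_
  · rintro ⟨π, ρ⟩ hp
    simp only [Finset.mem_product, Finset.mem_filter, Finset.mem_univ, true_and] at hp ⊢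
    refine ⟨(isPairing_blockPerm π ρ).2 hp, ?_⟩
    rintro ⟨i, j, hij⟩
    rw [blockPerm_castAdd] at hij
    have h1 := congrArg Fin.val hij
    have h2 := (π i).2
    simp only [Fin.val_castAdd, Fin.val_natAdd] at h1
    omega
  · intro p _ q _ h
    exact blockPerm_injective h
  · intro π hπ
    simp only [Finset.mem_filter, Finset.mem_univ, true_and] at hπ
    obtain ⟨π₁, π₂, rfl⟩ := exists_blockPerm hπ.2
    exact ⟨(π₁, π₂), by simpa [isPairing_blockPerm] using hπ.1, rfl⟩
  · rintro ⟨π, ρ⟩ hp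
    simp only [Finset.mem_product, Finset.mem_filter, Finset.mem_univ, true_and] at hp
    have c1 := two_mul_card_lt hp.1
    have c2 := two_mul_card_lt hp.2
    have c3 := two_mul_card_lt ((isPairing_blockPerm π ρ).2 hp)
    have c4 : (Finset.univ.filter fun i => i < blockPerm π ρ i).card
        = (Finset.univ.filter fun i => i < π i).card
          + (Finset.univ.filter fun i => i < ρ i).card := by omega
    rw [pairingWeight_blockPerm, blockPerm_mul, invariantCount_blockPerm]
    simp only [c4, pow_add]
    push_cast
    ring

end Genus

/-! ### Identification of the limit covariance -/

section Coefficient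

/-- If the degree were at least `e`, the quotient would tend to a nonzero leading coefficient or
blow up in absolute value. -/
theorem degree_lt_of_tendsto_div_natCast {p : Polynomial ℝ} {e : ℕ}
    (h : Tendsto (fun N : ℕ => p.eval (N : ℝ) / (N : ℝ) ^ e) atTop (𝓝 0)) : p.degree < e := by
  by_contra hlt
  rw [not_lt] at hlt
  have hX : (Polynomial.X ^ e : Polynomial ℝ).degree = e := Polynomial.degree_X_pow e
  have hp0 : p ≠ 0 := by
    rintro rfl
    simp at hlt
  rcases hlt.eq_or_lt with heq | hgt
  · have h1 := (Polynomial.div_tendsto_atTop_leadingCoeff_div_of_degree_eq p (Polynomial.X ^ e)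
      (by rw [hX, heq])).comp tendsto_natCast_atTop_atTop
    have h2 : Tendsto (fun N : ℕ => p.eval (N : ℝ) / (N : ℝ) ^ e) atTop
        (𝓝 (p.leadingCoeff / (Polynomial.X ^ e : Polynomial ℝ).leadingCoeff)) := by
      simpa [Function.comp_def] using h1
    have h3 := tendsto_nhds_unique h h2
    simp at h3
    exact hp0 (Polynomial.leadingCoeff_eq_zero.1 h3.symm)
  · have h1 := (Polynomial.abs_div_tendsto_atTop_atTop_of_degree_gt p (Polynomial.X ^ e)
      (by rwa [hX]) (pow_ne_zero _ Polynomial.X_ne_zero)).comp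
        (tendsto_natCast_atTop_atTop (R := ℝ))
    have h2 : Tendsto (fun N : ℕ => |p.eval (N : ℝ) / (N : ℝ) ^ e|) atTop atTop := by
      simpa [Function.comp_def] using h1
    exact not_tendsto_nhds_of_tendsto_atTop h2 _ h.abs

theorem coeff_eq_of_tendsto_div_natCast {p : Polynomial ℝ} {e : ℕ} {l : ℝ}
    (h : Tendsto (fun N : ℕ => p.eval (N : ℝ) / (N : ℝ) ^ e) atTop (𝓝 l)) : p.coeff e = l := by
  have h1 : Tendsto (fun N : ℕ =>
      (p - Polynomial.C l * Polynomial.X ^ e).eval (N : ℝ) / (N : ℝ) ^ e) atTop (𝓝 0) := by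
    have h2 := h.sub_const l
    rw [sub_self] at h2
    refine h2.congr' ?_
    filter_upwards [eventually_ne_atTop 0] with N hN
    have : (N : ℝ) ^ e ≠ 0 := pow_ne_zero _ (by exact_mod_cast hN)
    simp
    field_simp
  have h3 := Polynomial.coeff_eq_zero_of_degree_lt (degree_lt_of_tendsto_div_natCast h1)
  simp at h3
  linarith

variable {H : Type*} [NormedAddCommGroup H] [InnerProductSpace ℝ H]

theorem covList_nil_right (w : List H) : covList w [] = 0 := by
  induction hn : w.length using Nat.strong_induction_on generalizing w with
  | _ n ih =>
  cases w with
  | nil => exact covList_nil _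
  | cons f w =>
    rw [covList, Finset.sum_eq_zero, zero_add]
    · exact Finset.sum_eq_zero fun k _ => k.elim0
    · intro k _
      have hk := k.2
      rw [List.length_cons] at hn
      rw [ih _ (by simp; omega) (w.drop (k + 1)) rfl, ih _ (by simp; omega) (w.take k) rfl]
      ring

open Classical in
-- Centering constants do not affect a covariance, so the covariance of the two traces, which the
-- genus expansion turns into this sum, has the limit that the loop equation gives for the
-- fluctuations.
theorem tendsto_sum_connected {φ : ∀ N, MvPolynomial (H × Fin N × Fin N) ℂ →ₗ[ℂ] ℂ}
    (hφ : ∀ N, IsWick (φ N)) {n m : ℕ} (f : Fin (n + 1) → H) (g : Fin (m + 1) → H) :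
    Tendsto (fun N : ℕ =>
      ∑ π : Equiv.Perm (Fin (n + 1 + (m + 1))) with IsPairing π ∧
          ∃ (i : Fin (n + 1)) (j : Fin (m + 1)), π (Fin.castAdd (m + 1) i) = Fin.natAdd (n + 1) j,
        (pairingWeight (Fin.append f g) π : ℂ) *
        ((N : ℂ)⁻¹ ^ (Finset.univ.filter fun i => i < π i).card *
          invariantCount N (annularRotation (n + 1) (m + 1) * π)))
      atTop (𝓝 (covList (List.ofFn f) (List.ofFn g) : ℂ)) := by
  have h2 := tendsto_fluctMoment hφ [List.ofFn f, List.ofFn g]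
  have hf := tendsto_fluctMoment hφ [List.ofFn f]
  have hg := tendsto_fluctMoment hφ [List.ofFn g]
  have e1 : ∀ w : List H, wickSum [w] = 0 := fun w => by simp [wickSum_cons]
  have e2 : wickSum [List.ofFn f, List.ofFn g] = covList (List.ofFn f) (List.ofFn g) := by
    simp [wickSum_cons, wickSum_nil]
  rw [e1] at hf hg
  rw [e2] at h2
  have h3 := h2.sub (hf.mul hg)
  simp only [Complex.ofReal_zero, mul_zero, sub_zero] at h3
  refine h3.congr fun N => ?_
  have h4 := (hφ N).map_mul_sub (finRotate (n + 1)) (finRotate (m + 1)) f g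
  rw [← wordTrace_ofFn, ← wordTrace_ofFn] at h4
  refine Eq.trans ?_ h4
  have hC : ∀ c : ℂ, φ N (MvPolynomial.C c) = c := fun c => by
    rw [← mul_one (MvPolynomial.C c), ← MvPolynomial.smul_eq_C_mul, map_smul, (hφ N).map_one,
      smul_eq_mul, mul_one]
  have hCm : ∀ (c : ℂ) p, φ N (MvPolynomial.C c * p) = c * φ N p := fun c p => by
    rw [← MvPolynomial.smul_eq_C_mul, map_smul, smul_eq_mul]
  simp only [fluctMoment, List.map_cons, List.map_nil, List.prod_cons, List.prod_nil, mul_one,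
    wordFluct]
  rw [sub_mul, mul_sub, mul_comm _ (MvPolynomial.C _), map_sub, map_sub, map_sub, map_sub, hCm,
    hCm, map_sub, hC, hC]
  ring

/-- The sum over annular non-crossing pairings satisfies the loop equation. -/
theorem limitCov_eq_covList {φ : ∀ N, MvPolynomial (H × Fin N × Fin N) ℂ →ₗ[ℂ] ℂ}
    (hφ : ∀ N, IsWick (φ N)) {n m : ℕ} (f : Fin n → H) (g : Fin m → H) :
    limitCov f g = covList (List.ofFn f) (List.ofFn g) := by
  classical
  rcases n with _ | n
  · rw [List.ofFn_zero, covList_nil, limitCov]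
    refine Finset.sum_eq_zero fun π hπ => ?_
    obtain ⟨-, ⟨i, -⟩, -⟩ := (Finset.mem_filter.1 hπ).2
    exact i.elim0
  rcases m with _ | m
  · rw [List.ofFn_zero, covList_nil_right, limitCov]
    refine Finset.sum_eq_zero fun π hπ => ?_
    obtain ⟨-, ⟨-, j, -⟩, -⟩ := (Finset.mem_filter.1 hπ).2
    exact j.elim0
  set γ := annularRotation (n + 1) (m + 1)
  set conn : Finset (Equiv.Perm (Fin (n + 1 + (m + 1)))) := Finset.univ.filter fun π =>
    IsPairing π ∧
      ∃ (i : Fin (n + 1)) (j : Fin (m + 1)), π (Fin.castAdd (m + 1) i) = Fin.natAdd (n + 1) j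
    with hconn
  set e : ℕ := (n + 1 + (m + 1)) / 2 with he
  have hcard : ∀ π ∈ conn, 2 * (Finset.univ.filter fun i => i < π i).card = n + 1 + (m + 1) :=
    fun π hπ => two_mul_card_lt (Finset.mem_filter.1 hπ).2.1
  -- Each pairing has `e` blocks, so the connected sum is `p(N) / N^e`. Its known finite limit is
  -- the coefficient of `N^e`, which collects exactly the connected pairings for which `γ * π` has
  -- `e` cycles.
  let p : Polynomial ℝ := ∑ π ∈ conn,
    Polynomial.C (pairingWeight (Fin.append f g) π) * Polynomial.X ^ numCycles (γ * π)
  have hp : Tendsto (fun N : ℕ => p.eval (N : ℝ) / (N : ℝ) ^ e) atTop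
      (𝓝 (covList (List.ofFn f) (List.ofFn g))) := by
    rw [← tendsto_ofReal_iff]
    refine (tendsto_sum_connected hφ f g).congr fun N => ?_
    simp only [p, Polynomial.eval_finsetSum, Finset.sum_div]
    push_cast
    refine Finset.sum_congr rfl fun π hπ => ?_
    have hc : (Finset.univ.filter fun i => i < π i).card = e := by
      have := hcard π hπ
      omega
    rw [hc, invariantCount_eq_pow]
    simp
    ring
  rw [← coeff_eq_of_tendsto_div_natCast hp, limitCov, annularNC2]
  simp only [p, Polynomial.finsetSum_coeff, Polynomial.coeff_C_mul, Polynomial.coeff_X_pow,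
    mul_ite, mul_one, mul_zero]
  rw [← Finset.sum_filter]
  refine Finset.sum_congr ?_ fun _ _ => rfl
  ext π
  simp only [hconn, Finset.mem_filter, Finset.mem_univ, true_and, and_assoc]
  refine and_congr_right fun h1 => and_congr_right fun h2 => ?_
  have := two_mul_card_lt h1
  change 2 * numCycles (γ * π) = _ ↔ _
  omega

end Coefficient

/-! ### Hermitian Gaussian families as Wick functionals -/

section Family

variable {H : Type*} [NormedAddCommGroup H] [InnerProductSpace ℝ H] {N : ℕ}
  {Ω : Type*} {mΩ : MeasurableSpace Ω} {P : Measure Ω} {X : H → Ω → Matrix (Fin N) (Fin N) ℂ}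

/-- The entries of a family of random matrices, as one family of random variables. -/
def entry (X : H → Ω → Matrix (Fin N) (Fin N) ℂ) (t : H × Fin N × Fin N) (ω : Ω) : ℂ :=
  X t.1 ω t.2.1 t.2.2

theorem IsHermitianGaussianFamily.hasMoments (hX : IsHermitianGaussianFamily P X)
    (t : H × Fin N × Fin N) : HasMoments (entry X t) P :=
  hasMoments_of_hasGaussianLaw (hX.gaussian.hasGaussianLaw_eval t)

theorem IsHermitianGaussianFamily.ae_apply (hX : IsHermitianGaussianFamily P X) (f : H)
    (i j : Fin N) : ∀ᵐ ω ∂P, conj (X f ω j i) = X f ω i j := by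
  filter_upwards [hX.hermitian f] with ω h
  exact h.apply i j

/-- The hypotheses cover only entries on or above the diagonal; Hermitian symmetry replaces the
others by conjugates, whence the cases according to the order of the indices. -/
theorem IsHermitianGaussianFamily.integral_mul (hX : IsHermitianGaussianFamily P X)
    (s t : H × Fin N × Fin N) : ∫ ω, entry X s ω * entry X t ω ∂P = entryCov s t := by
  obtain ⟨f, i, j⟩ := s
  obtain ⟨g, k, l⟩ := t
  simp only [entry, entryCov]
  rcases le_or_gt i j with hij | hij
  · rcases le_or_gt l k with hkl | hkl
    · rw [← hX.cov f g i j l k hij hkl]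
      refine integral_congr_ae ?_
      filter_upwards [hX.ae_apply g k l] with ω h
      rw [h]
    · rcases hij.eq_or_lt with rfl | hij
      · rw [if_neg (by rintro ⟨rfl, rfl⟩; exact lt_irrefl _ hkl)]
        have := hX.cov g f k l i i hkl.le le_rfl
        rw [if_neg (by rintro ⟨rfl, rfl⟩; exact lt_irrefl _ hkl)] at this
        rw [← this]
        refine integral_congr_ae ?_
        filter_upwards [hX.ae_apply f i i] with ω h
        rw [h, mul_comm]
      · rw [if_neg (by rintro ⟨rfl, rfl⟩; exact lt_asymm hij hkl)]
        exact hX.pseudoCov f g i j k l hij hkl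
  · rcases le_or_gt k l with hkl | hkl
    · have := hX.cov g f k l j i hkl hij.le
      rw [real_inner_comm] at this
      have hiff : (i = l ∧ j = k) ↔ (k = j ∧ l = i) :=
        ⟨fun h => ⟨h.2.symm, h.1.symm⟩, fun h => ⟨h.2.symm, h.1.symm⟩⟩
      simp only [hiff]
      rw [← this]
      refine integral_congr_ae ?_
      filter_upwards [hX.ae_apply f i j] with ω h
      rw [h, mul_comm]
    · rw [if_neg (by rintro ⟨rfl, rfl⟩; exact lt_asymm hij hkl)]
      have := hX.pseudoCov f g j i l k hij hkl
      rw [← map_zero (starRingEnd ℂ), ← this, ← integral_conj]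
      refine integral_congr_ae ?_
      filter_upwards [hX.ae_apply f i j, hX.ae_apply g k l] with ω h h'
      rw [map_mul, h, h']

variable [IsProbabilityMeasure P]

/-- The expectation of polynomials in the entries. -/
noncomputable def IsHermitianGaussianFamily.expectation (hX : IsHermitianGaussianFamily P X) :
    MvPolynomial (H × Fin N × Fin N) ℂ →ₗ[ℂ] ℂ where
  toFun p := ∫ ω, MvPolynomial.aeval (fun t => entry X t ω) p ∂P
  map_add' p q := by
    simp only [map_add]
    exact integral_add (hasMoments_aeval hX.hasMoments p).integrable
      (hasMoments_aeval hX.hasMoments q).integrable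
  map_smul' c p := by
    simp only [map_smul, smul_eq_mul, RingHom.id_apply]
    exact integral_const_mul _ _

theorem IsHermitianGaussianFamily.isWick (hX : IsHermitianGaussianFamily P X) :
    IsWick hX.expectation where
  map_one := by simp [expectation]
  map_X_mul s p := by
    have := integral_X_mul_aeval (X := entry X) hX.gaussian (fun t => hX.centered _ _ _) s
      (entryCov s) (hX.integral_mul s) p
    simpa [expectation, contraction] using this

omit [IsProbabilityMeasure P] in
theorem alphaList_ofFn {n : ℕ} (f : Fin n → H) : alphaList (List.ofFn f) = alpha f := by
  have key : ∀ (m : ℕ) (h : m = n) (g : Fin m → H), (∀ i, g i = f (Fin.cast h i)) →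
      alpha g = alpha f := by
    rintro m rfl g hg
    congr 1
    exact funext hg
  exact key _ List.length_ofFn _ fun i => by simp [Fin.cast]

theorem aeval_wordFluct {n : ℕ} (f : Fin n → H) (ω : Ω) :
    MvPolynomial.aeval (fun t => entry X t ω) (wordFluct N (List.ofFn f)) = fluctuation X f ω := by
  let ev : MvPolynomial (H × Fin N × Fin N) ℂ →ₐ[ℂ] ℂ := MvPolynomial.aeval fun t => entry X t ω
  have h1 : (wordMat N (List.ofFn f)).map ev = (List.ofFn fun k => X (f k) ω).prod := by
    have h2 : ev.mapMatrix (wordMat N (List.ofFn f)) = _ := map_list_prod _ _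
    rw [AlgHom.mapMatrix_apply] at h2
    rw [h2, List.map_ofFn, List.map_ofFn]
    congr 2
    ext k i j
    simp [genMat, ev, entry]
  rw [fluctuation, ← h1, ← alphaList_ofFn, wordFluct, map_sub, wordTrace]
  congr 1
  · change ev _ = _
    rw [AddMonoidHom.map_trace ev]
  · simp

theorem integral_prod_fluctuation (hX : IsHermitianGaussianFamily P X)
    (L : List (Σ n : ℕ, Fin n → H)) :
    ∫ ω, (L.map fun w => fluctuation X w.2 ω).prod ∂P
      = fluctMoment hX.expectation (L.map fun w => List.ofFn w.2) := by
  rw [fluctMoment, List.map_map]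
  simp only [IsHermitianGaussianFamily.expectation, LinearMap.coe_mk, AddHom.coe_mk,
    map_list_prod, List.map_map, Function.comp_def, aeval_wordFluct]

theorem hasMoments_fluctuation (hX : IsHermitianGaussianFamily P X) {n : ℕ} (f : Fin n → H) :
    HasMoments (fluctuation X f) P := by
  have := hasMoments_aeval hX.hasMoments (wordFluct N (List.ofFn f))
  simpa only [aeval_wordFluct] using this

omit [IsProbabilityMeasure P] in
-- Conjugation by the reversal preserves non-crossing pairings, and real inner products are
-- symmetric. Hence the centering constant survives conjugation of the trace.
theorem alpha_rev {n : ℕ} (f : Fin n → H) : alpha (fun i => f i.rev) = alpha f := by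
  classical
  let r : Equiv.Perm (Fin n) := Fin.revPerm
  have hconj : ∀ (π : Equiv.Perm (Fin n)) (i : Fin n),
      (r * π * r) i = (π i.rev).rev := fun π i => rfl
  have hinv : ∀ π : Equiv.Perm (Fin n),
      r * (r * π * r) * r = π := fun π => by
    ext i
    simp [hconj]
  have hmem : ∀ π ∈ NC2 n, r * π * r ∈ NC2 n := by
    intro π hπ
    obtain ⟨hp, hnc⟩ := (Finset.mem_filter.1 hπ).2
    refine Finset.mem_filter.2 ⟨Finset.mem_univ _, fun i => ⟨fun h => ?_, ?_⟩, ?_⟩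
    · rw [hconj] at h
      exact (hp i.rev).1 (Fin.rev_injective (by rw [Fin.rev_rev]; exact h))
    · rw [hconj, hconj, Fin.rev_rev, (hp _).2, Fin.rev_rev]
    · rintro i j ⟨h1, h2, h3⟩
      rw [hconj] at h2 h3
      rw [hconj] at h3
      refine hnc (π j.rev) (π i.rev) ⟨Fin.rev_lt_rev.1 h3, ?_, ?_⟩
      · rw [(hp _).2]
        exact Fin.rev_lt_rev.1 (by rwa [Fin.rev_rev])
      · rw [(hp _).2, (hp _).2]
        exact Fin.rev_lt_rev.2 h1
  refine Finset.sum_nbij' (fun π => r * π * r)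
    (fun π => r * π * r) hmem hmem (fun π _ => hinv π) (fun π _ => hinv π) ?_
  intro π hπ
  obtain ⟨hp, -⟩ := (Finset.mem_filter.1 hπ).2
  refine Finset.prod_nbij' (fun i => (π i).rev) (fun i => π i.rev) ?_ ?_ ?_ ?_ ?_
  · intro i hi
    simpa [hconj, (hp i).2] using hi
  · intro i hi
    simp only [Finset.mem_filter, Finset.mem_univ, true_and, hconj] at hi ⊢
    rw [(hp _).2]
    exact Fin.rev_lt_rev.1 (by rwa [Fin.rev_rev])
  · intro i _
    simp [(hp i).2]
  · intro i _
    simp [(hp i.rev).2]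
  · intro i _
    rw [hconj, Fin.rev_rev, (hp i).2, real_inner_comm]

omit [IsProbabilityMeasure P] in
/-- The fluctuation of the reversed word is the complex conjugate. -/
theorem conj_fluctuation (hX : IsHermitianGaussianFamily P X) {n : ℕ} (f : Fin n → H) :
    ∀ᵐ ω ∂P, conj (fluctuation X f ω) = fluctuation X (fun i => f i.rev) ω := by
  have h := fun k => hX.hermitian (f k)
  rw [← ae_all_iff] at h
  filter_upwards [h] with ω hω
  rw [fluctuation, fluctuation, alpha_rev, map_sub]
  congr 1
  · have h1 := Matrix.trace_conjTranspose (List.ofFn fun k => X (f k) ω).prod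
    rw [← starRingEnd_apply] at h1
    rw [← h1, Matrix.conjTranspose_list_prod, List.map_ofFn]
    congr 2
    refine List.ext_getElem (by simp) fun i h1 h2 => ?_
    simp only [List.length_reverse, List.length_ofFn] at h1
    rw [List.getElem_reverse]
    simp only [List.getElem_ofFn, List.length_ofFn, Function.comp_apply]
    rw [(hω _).eq]
    congr 2
    ext
    simp
    omega
  · simp

end Family

/-! ### Isonormal Gaussian processes -/

section Isonormal

/-- Convergence in `L²` implies convergence in measure, hence in distribution, hence of
characteristic functions. -/
theorem continuous_charFun_map_Lp {Ω : Type*} {mΩ : MeasurableSpace Ω} (P : Measure Ω)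
    [IsProbabilityMeasure P] (t : ℝ) :
    Continuous fun f : Lp ℝ 2 P => charFun (P.map f) t := by
  refine continuous_iff_seqContinuous.2 fun f g h => ?_
  have h' := (tendstoInMeasure_of_tendsto_Lp h).tendstoInDistribution_of_aemeasurable
    (fun n => (Lp.aestronglyMeasurable (f n)).aemeasurable)
    (Lp.aestronglyMeasurable g).aemeasurable
  exact ProbabilityMeasure.tendsto_iff_tendsto_charFun.1 h'.tendsto t

theorem map_Lp_eq_gaussianReal {Ω : Type*} {mΩ : MeasurableSpace Ω} {P : Measure Ω}
    [IsProbabilityMeasure P] {ι : Type*} {ξ : ι → Lp ℝ 2 P}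
    (hG : ∀ i, HasGaussianLaw (ξ i) P) (h0 : ∀ i, ∫ ω, ξ i ω ∂P = 0)
    (hI : iIndepFun (fun i => (ξ i : Ω → ℝ)) P) {x : Lp ℝ 2 P}
    (hx : x ∈ Submodule.span ℝ (Set.range ξ)) :
    P.map x = gaussianReal 0 (‖x‖ ^ 2).toNNReal := by
  obtain ⟨c, rfl⟩ := Finsupp.mem_span_range_iff_exists_finsupp.1 hx
  set x := c.sum fun i a => a • ξ i with hxdef
  have hcoe : (x : Ω → ℝ) =ᵐ[P] fun ω => ∑ i : c.support, c i * ξ i ω := by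
    have h1 : x = ∑ i : c.support, c i • ξ i := by
      rw [hxdef, Finsupp.sum, ← Finset.sum_coe_sort]
    rw [h1]
    refine (Lp.coeFn_fun_finsetSum _ _).trans ?_
    have h2 : ∀ i : c.support, ((c i • ξ i : Lp ℝ 2 P) : Ω → ℝ) =ᵐ[P] fun ω => c i * ξ i ω :=
      fun i => Lp.coeFn_smul _ _
    filter_upwards [ae_all_iff.2 h2] with ω hω
    exact Finset.sum_congr rfl fun i _ => hω i
  have hlaw : HasGaussianLaw (x : Ω → ℝ) P := by
    have h1 : iIndepFun (fun (i : c.support) (ω : Ω) => c i * ξ i ω) P :=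
      (hI.precomp Subtype.val_injective).comp (fun (i : c.support) (y : ℝ) => c i * y)
        fun i => measurable_const_mul _
    have h2 := iIndepFun.hasGaussianLaw_fun_sum
      (fun i : c.support => (hG i).smul (c i)) h1
    exact h2.congr hcoe.symm
  have hint : ∫ ω, x ω ∂P = 0 := by
    rw [integral_congr_ae hcoe, integral_finsetSum]
    swap
    · exact fun i _ => (hG i).integrable.const_mul _
    simp [integral_const_mul, h0]
  rw [hlaw.map_eq_gaussianReal, hint, variance_of_integral_eq_zero hlaw.aemeasurable hint,
    ← real_inner_self_eq_norm_sq, L2.inner_def]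
  simp [sq]

/-- Independent standard normal variables indexed by a Hilbert basis are orthonormal in `L²`, so the
basis extends to a linear isometry. -/
theorem exists_isonormal (E : Type u) [NormedAddCommGroup E] [InnerProductSpace ℝ E]
    [CompleteSpace E] :
    ∃ (Ω : Type u) (_ : MeasurableSpace Ω) (P : Measure Ω) (_ : IsProbabilityMeasure P)
      (W : E →ₗᵢ[ℝ] Lp ℝ 2 P), ∀ x, P.map (W x) = gaussianReal 0 (‖x‖ ^ 2).toNNReal := by
  classical
  obtain ⟨w, b, hb⟩ := exists_hilbertBasis ℝ E
  let P : Measure (w → ℝ) := Measure.infinitePi fun _ => gaussianReal 0 1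
  have hmap : ∀ i : w, P.map (fun ω => ω i) = gaussianReal 0 1 :=
    fun i => Measure.infinitePi_map_eval _ i
  have hlaw : ∀ i : w, HasGaussianLaw (fun ω : w → ℝ => ω i) P := fun i =>
    ⟨by rw [hmap]; infer_instance⟩
  have hmem : ∀ i : w, MemLp (fun ω : w → ℝ => ω i) 2 P := fun i => (hlaw i).memLp_two
  let ξ : w → Lp ℝ 2 P := fun i => (hmem i).toLp
  have hξ : ∀ i, ξ i =ᵐ[P] fun ω => ω i := fun i => (hmem i).coeFn_toLp
  have hI : iIndepFun (fun i => (ξ i : (w → ℝ) → ℝ)) P :=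
    (iIndepFun_infinitePi (X := fun (_ : w) (y : ℝ) => y) fun _ => measurable_id).congr
      fun i => (hξ i).symm
  have hG : ∀ i, HasGaussianLaw (ξ i) P := fun i => (hlaw i).congr (hξ i).symm
  have hmapξ : ∀ i, P.map (ξ i) = gaussianReal 0 1 := fun i => by
    rw [Measure.map_congr (hξ i), hmap]
  have h0 : ∀ i, ∫ ω, ξ i ω ∂P = 0 := fun i => by
    have := integral_map (μ := P) (hG i).aemeasurable (f := fun y : ℝ => y) (by fun_prop)
    rw [← this, hmapξ, integral_id_gaussianReal]
  have hon : Orthonormal ℝ ξ := by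
    rw [orthonormal_iff_ite]
    intro i j
    rw [L2.inner_def]
    split_ifs with hij
    · subst hij
      have hv : Var[ξ i; P] = 1 := by
        rw [← variance_id_map (hG i).aemeasurable, hmapξ, variance_id_gaussianReal]
        rfl
      rw [variance_of_integral_eq_zero (hG i).aemeasurable (h0 i)] at hv
      simpa [sq] using hv
    · have := (hI.indepFun hij).integral_fun_mul_eq_mul_integral
        (hG i).aemeasurable.aestronglyMeasurable (hG j).aemeasurable.aestronglyMeasurable
      simp only [h0, mul_zero] at this
      simpa [mul_comm] using this
  let W : E →ₗᵢ[ℝ] Lp ℝ 2 P :=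
    hon.orthogonalFamily.linearIsometry.comp b.repr.toLinearIsometry
  have hW : ∀ i, W (b i) = ξ i := fun i => by
    simp [W, b.repr_self, OrthogonalFamily.linearIsometry_apply_single]
  refine ⟨w → ℝ, inferInstance, P, inferInstance, W, ?_⟩
  -- On the span of the basis the law is that of a finite sum of independent Gaussians. Both
  -- characteristic functions depend continuously on `x`, so density gives the rest.
  have key : ∀ t : ℝ, (fun x => charFun (P.map (W x)) t) =
      fun x => charFun (gaussianReal 0 (‖x‖ ^ 2).toNNReal) t := by
    intro t
    refine Continuous.ext_on (s := (Submodule.span ℝ (Set.range b) : Set E)) ?_ ?_ ?_ ?_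
    · exact Submodule.dense_iff_topologicalClosure_eq_top.2 b.dense_span
    · exact (continuous_charFun_map_Lp P t).comp W.continuous
    · simp only [charFun_gaussianReal]
      fun_prop
    · intro x hx
      have : W x ∈ Submodule.span ℝ (Set.range ξ) := by
        have h1 := Submodule.mem_map_of_mem (f := W.toLinearMap) hx
        rw [Submodule.map_span, ← Set.range_comp] at h1
        have h2 : ⇑W.toLinearMap ∘ ⇑b = ξ := funext hW
        rwa [h2] at h1
      simp only
      rw [map_Lp_eq_gaussianReal hG h0 hI this, W.norm_map]
  intro x
  have : IsProbabilityMeasure (P.map (W x)) :=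
    Measure.isProbabilityMeasure_map (Lp.aestronglyMeasurable _).aemeasurable
  exact Measure.ext_of_charFun (funext fun t => congrFun (key t) x)

end Isonormal

/-! ### Real Gaussian processes with a prescribed covariance -/

section GaussianProcess

/-- The feature vectors are the kernel sections in the reproducing kernel Hilbert space of the
scalar kernel `K`. -/
theorem exists_inner_eq_of_posSemidef {T : Type u} {K : T → T → ℝ} (hsymm : ∀ s t, K s t = K t s)
    (hpos : ∀ c : T →₀ ℝ, 0 ≤ c.sum fun s a => c.sum fun t b => a * b * K s t) :
    ∃ (E : Type u) (_ : NormedAddCommGroup E) (_ : InnerProductSpace ℝ E) (_ : CompleteSpace E)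
      (x : T → E), ∀ s t, inner ℝ (x s) (x t) = K s t := by
  let M : Matrix T T (ℝ →L[ℝ] ℝ) := .of fun s t => K s t • ContinuousLinearMap.id ℝ ℝ
  have hM : M.PosSemidef := by
    have key := (RKHS.posSemidef_tfae (𝕜 := ℝ) (K := M)).out 0 2
    refine key.2 ⟨?_, fun c => ?_⟩
    · refine Matrix.IsHermitian.ext fun s t => ?_
      simp only [M, Matrix.of_apply, star_smul, star_trivial, hsymm t s]
      congr 1
      exact ContinuousLinearMap.adjoint_id
    · convert hpos c using 1
      simp only [Finsupp.sum, RCLike.re_to_real]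
      refine Finset.sum_congr rfl fun s _ => Finset.sum_congr rfl fun t _ => ?_
      simp [M, hsymm t s]
      ring
  have : Fact M.PosSemidef := ⟨hM⟩
  refine ⟨RKHS.OfKernel M, inferInstance, inferInstance, inferInstance,
    fun t => RKHS.kerFun (RKHS.OfKernel M) t 1, fun s t => ?_⟩
  rw [← RKHS.kernel_inner, RKHS.OfKernel.kernel_ofKernel]
  simp [M, hsymm t s]

theorem exists_gaussianProcess {T : Type u} {K : T → T → ℝ} (hsymm : ∀ s t, K s t = K t s)
    (hpos : ∀ c : T →₀ ℝ, 0 ≤ c.sum fun s a => c.sum fun t b => a * b * K s t) :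
    ∃ (Ω : Type u) (_ : MeasurableSpace Ω) (P : Measure Ω) (_ : IsProbabilityMeasure P)
      (g : T → Ω → ℝ), IsGaussianProcess g P ∧ (∀ t, ∫ ω, g t ω ∂P = 0) ∧
        ∀ s t, ∫ ω, g s ω * g t ω ∂P = K s t := by
  classical
  obtain ⟨E, _, _, _, x, hx⟩ := exists_inner_eq_of_posSemidef hsymm hpos
  obtain ⟨Ω, _, P, _, W, hW⟩ := exists_isonormal E
  have hmeas : ∀ y, AEMeasurable (W y) P := fun y => (Lp.aestronglyMeasurable _).aemeasurable
  refine ⟨Ω, inferInstance, P, inferInstance, fun t => W (x t), ⟨fun I => ⟨?_⟩⟩, fun t => ?_,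
    fun s t => ?_⟩
  · refine isGaussian_of_map_eq_gaussianReal fun L =>
      ⟨0, (‖∑ i : I, L (Pi.single i 1) • x i‖ ^ 2).toNNReal, ?_⟩
    have hm : AEMeasurable (fun ω => I.restrict fun t => W (x t) ω) P :=
      aemeasurable_pi_lambda _ fun i => hmeas _
    rw [AEMeasurable.map_map_of_aemeasurable L.measurable.aemeasurable hm, ← hW]
    refine Measure.map_congr ?_
    rw [map_sum]
    refine Filter.EventuallyEq.trans ?_ (Lp.coeFn_fun_finsetSum _ _).symm
    have h2 : ∀ i : I, (W (L (Pi.single i 1) • x i) : Ω → ℝ) =ᵐ[P]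
        fun ω => L (Pi.single i 1) * W (x i) ω := fun i => by
      rw [map_smul]
      exact Lp.coeFn_smul _ _
    filter_upwards [ae_all_iff.2 h2] with ω hω
    simp only [Function.comp_apply, hω]
    conv_lhs => rw [pi_eq_sum_univ' (I.restrict fun t => W (x t) ω), map_sum]
    refine Finset.sum_congr rfl fun i _ => ?_
    rw [map_smul, smul_eq_mul, mul_comm]
    rfl
  · have := integral_map (hmeas (x t)) (f := fun y : ℝ => y) (by fun_prop)
    rw [← this, hW, integral_id_gaussianReal]
  · rw [← hx, ← W.inner_map_map, L2.inner_def]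
    simp [mul_comm]

end GaussianProcess

/-! ### Moments control characteristic functions -/

section MethodOfMoments

theorem hasDerivAt_sum_pow_div_factorial (c : ℂ) (n : ℕ) (x : ℝ) :
    HasDerivAt (fun x : ℝ => ∑ k ∈ Finset.range (n + 1), (x * c) ^ k / (k.factorial : ℂ))
      (c * ∑ k ∈ Finset.range n, (x * c) ^ k / (k.factorial : ℂ)) x := by
  induction n with
  | zero => simpa using hasDerivAt_const x (1 : ℂ)
  | succ n ih =>
    have h1 : HasDerivAt (fun x : ℝ => (x : ℂ) * c) c x := by
      simpa using (hasDerivAt_id x).ofReal_comp.mul_const c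
    have h2 := (h1.pow (n + 1)).div_const ((n + 1).factorial : ℂ)
    have h3 := ih.add h2
    simp only [Finset.sum_range_succ _ (n + 1)]
    refine h3.congr_deriv ?_
    rw [Finset.sum_range_succ _ n, mul_add]
    congr 1
    have h4 : ((n : ℂ) + 1) ≠ 0 := by exact_mod_cast n.succ_ne_zero
    have h5 : (n.factorial : ℂ) ≠ 0 := by exact_mod_cast n.factorial_ne_zero
    rw [Nat.factorial_succ]
    push_cast
    field_simp

/-- The derivative of each Taylor remainder is `c` times the previous one, so the bound integrates
up by induction. Vanishing real part enters only at the start, where the exponential has modulus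
one. -/
theorem norm_exp_sub_sum_le_of_re_eq_zero {c : ℂ} (hc : c.re = 0) (n : ℕ) {x : ℝ} (hx : 0 ≤ x) :
    ‖Complex.exp (x * c) - ∑ k ∈ Finset.range n, (x * c) ^ k / (k.factorial : ℂ)‖ ≤
      (‖c‖ * x) ^ n / n.factorial := by
  induction n generalizing x with
  | zero => simp [Complex.norm_exp, hc]
  | succ n ih =>
    have hf : ∀ y : ℝ, HasDerivAt (fun y : ℝ => Complex.exp (y * c) -
        ∑ k ∈ Finset.range (n + 1), (y * c) ^ k / (k.factorial : ℂ))
        (c * (Complex.exp (y * c) - ∑ k ∈ Finset.range n, (y * c) ^ k / (k.factorial : ℂ))) y := by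
      intro y
      have h1 : HasDerivAt (fun x : ℝ => (x : ℂ) * c) c y := by
        simpa using (hasDerivAt_id y).ofReal_comp.mul_const c
      refine (h1.cexp.sub (hasDerivAt_sum_pow_div_factorial c n y)).congr_deriv ?_
      ring
    have hB : ∀ y : ℝ, HasDerivAt (fun y : ℝ => (‖c‖ * y) ^ (n + 1) / (n + 1).factorial)
        (‖c‖ * ((‖c‖ * y) ^ n / n.factorial)) y := by
      intro y
      have h1 : HasDerivAt (fun y : ℝ => ‖c‖ * y) ‖c‖ y := by
        simpa using (hasDerivAt_id y).const_mul ‖c‖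
      refine ((h1.pow (n + 1)).div_const ((n + 1).factorial : ℝ)).congr_deriv ?_
      have h4 : ((n : ℝ) + 1) ≠ 0 := by exact_mod_cast n.succ_ne_zero
      have h5 : (n.factorial : ℝ) ≠ 0 := by exact_mod_cast n.factorial_ne_zero
      rw [Nat.factorial_succ]
      push_cast
      field_simp
    refine image_norm_le_of_norm_deriv_right_le_deriv_boundary
      (f := fun y : ℝ => Complex.exp (y * c) -
        ∑ k ∈ Finset.range (n + 1), (y * c) ^ k / (k.factorial : ℂ)) (a := 0) (b := x)
      (fun y _ => (hf y).continuousAt.continuousWithinAt)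
      (fun y _ => (hf y).hasDerivWithinAt) ?_ hB (fun y hy => ?_) ⟨hx, le_rfl⟩
    · simp [Finset.sum_range_succ']
    · rw [norm_mul]
      exact mul_le_mul_of_nonneg_left (ih hy.1) (norm_nonneg _)

theorem norm_exp_mul_I_sub_sum_le (y : ℝ) (n : ℕ) :
    ‖Complex.exp (y * Complex.I) -
      ∑ k ∈ Finset.range n, Complex.I ^ k / (k.factorial : ℂ) * ((y ^ k : ℝ) : ℂ)‖ ≤
      |y| ^ n / n.factorial := by
  have h := norm_exp_sub_sum_le_of_re_eq_zero (c := y * Complex.I) (by simp) n zero_le_one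
  convert h using 3
  · simp
  · refine Finset.sum_congr rfl fun k _ => ?_
    push_cast
    rw [one_mul, mul_pow]
    ring
  · simp

/-- The even order `2 * q` makes the remainder bound a moment of `Y` itself, so it converges along
with the moments. -/
theorem norm_integral_exp_sub_sum_le {Ω : Type*} {mΩ : MeasurableSpace Ω} {P : Measure Ω}
    [IsProbabilityMeasure P] {Y : Ω → ℝ} (hm : AEMeasurable Y P)
    (hY : ∀ p : ℕ, Integrable (fun ω => Y ω ^ p) P) (q : ℕ) :
    ‖∫ ω, Complex.exp (Y ω * Complex.I) ∂P - ∑ k ∈ Finset.range (2 * q),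
      Complex.I ^ k / (k.factorial : ℂ) * ((∫ ω, Y ω ^ k ∂P : ℝ) : ℂ)‖ ≤
      (∫ ω, Y ω ^ (2 * q) ∂P) / (2 * q).factorial := by
  have h1 : Integrable (fun ω => Complex.exp (Y ω * Complex.I)) P := by
    refine Integrable.of_bound (C := 1) ?_ (ae_of_all _ fun ω => ?_)
    · exact (Complex.measurable_exp.comp_aemeasurable
        ((Complex.measurable_ofReal.comp_aemeasurable hm).mul_const _)).aestronglyMeasurable
    · rw [Complex.norm_exp_ofReal_mul_I]
  have h2 : ∀ k ∈ Finset.range (2 * q), Integrable (fun ω =>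
      Complex.I ^ k / (k.factorial : ℂ) * ((Y ω ^ k : ℝ) : ℂ)) P :=
    fun k _ => (hY k).ofReal.const_mul _
  have h3 : ∑ k ∈ Finset.range (2 * q),
      Complex.I ^ k / (k.factorial : ℂ) * ((∫ ω, Y ω ^ k ∂P : ℝ) : ℂ) =
      ∫ ω, ∑ k ∈ Finset.range (2 * q),
        Complex.I ^ k / (k.factorial : ℂ) * ((Y ω ^ k : ℝ) : ℂ) ∂P := by
    rw [integral_finsetSum _ h2]
    refine Finset.sum_congr rfl fun k _ => ?_
    rw [integral_const_mul, integral_complex_ofReal]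
  rw [h3, ← integral_sub h1 (integrable_finsetSum _ h2), ← integral_div]
  refine norm_integral_le_of_norm_le ((hY _).div_const _) (ae_of_all _ fun ω => ?_)
  refine (norm_exp_mul_I_sub_sum_le (Y ω) (2 * q)).trans (le_of_eq ?_)
  rw [pow_mul, sq_abs, ← pow_mul]

theorem tendsto_of_approx {a : ℕ → ℂ} {l : ℂ} {b : ℕ → ℕ → ℂ} {b' : ℕ → ℂ} {e : ℕ → ℕ → ℝ}
    {e' : ℕ → ℝ} (hb : ∀ q, Tendsto (b q) atTop (𝓝 (b' q)))
    (he : ∀ q, Tendsto (e q) atTop (𝓝 (e' q))) (he' : Tendsto e' atTop (𝓝 0))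
    (ha : ∀ q N, ‖a N - b q N‖ ≤ e q N) (hl : ∀ q, ‖l - b' q‖ ≤ e' q) :
    Tendsto a atTop (𝓝 l) := by
  refine Metric.tendsto_atTop'.2 fun ε hε => ?_
  obtain ⟨q, hq⟩ := (he'.eventually_lt_const (show 0 < ε / 3 by positivity)).exists
  have h1 := (he q).eventually_lt_const hq
  have h2 := Metric.tendsto_nhds.1 (hb q) (ε / 3) (by positivity)
  obtain ⟨M, hM⟩ := eventually_atTop.1 (h1.and h2)
  refine ⟨M, fun N hN => ?_⟩
  obtain ⟨h3, h4⟩ := hM N hN.le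
  rw [dist_eq_norm] at h4 ⊢
  have h5 : a N - l = (a N - b q N) + (b q N - b' q) - (l - b' q) := by ring
  rw [h5]
  refine (norm_sub_le _ _).trans_lt ((add_le_add_left (norm_add_le _ _) _).trans_lt ?_)
  have := ha q N
  have := hl q
  linarith

/-- Truncate the exponential series at order `2 * q`. For fixed `q` the partial sums and the error
bounds converge in `N`; the limiting error bound tends to zero in `q`, since `exp Y' + exp (-Y')` is
an integrable majorant. -/
theorem tendsto_integral_exp_of_tendsto_moments {Ω : ℕ → Type*} {mΩ : ∀ N, MeasurableSpace (Ω N)}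
    {P : ∀ N, Measure (Ω N)} [∀ N, IsProbabilityMeasure (P N)] {Ω' : Type*}
    {mΩ' : MeasurableSpace Ω'} {P' : Measure Ω'} [IsProbabilityMeasure P']
    {Y : ∀ N, Ω N → ℝ} {Y' : Ω' → ℝ} (hm : ∀ N, AEMeasurable (Y N) (P N))
    (hY : ∀ N (p : ℕ), Integrable (fun ω => Y N ω ^ p) (P N)) (hm' : AEMeasurable Y' P')
    (hY' : ∀ p : ℕ, Integrable (fun ω => Y' ω ^ p) P')
    (hpos : Integrable (fun ω => Real.exp (Y' ω)) P')
    (hneg : Integrable (fun ω => Real.exp (- Y' ω)) P')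
    (h : ∀ p : ℕ, Tendsto (fun N => ∫ ω, Y N ω ^ p ∂(P N)) atTop (𝓝 (∫ ω, Y' ω ^ p ∂P'))) :
    Tendsto (fun N => ∫ ω, Complex.exp (Y N ω * Complex.I) ∂(P N)) atTop
      (𝓝 (∫ ω, Complex.exp (Y' ω * Complex.I) ∂P')) := by
  refine tendsto_of_approx (fun q => ?_) (fun q => ?_) ?_
    (fun q N => norm_integral_exp_sub_sum_le (hm N) (hY N) q)
    (norm_integral_exp_sub_sum_le hm' hY')
  · exact tendsto_finsetSum _ fun k _ =>
      ((Complex.continuous_ofReal.tendsto _).comp (h k)).const_mul _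
  · exact (h (2 * q)).div_const _
  · have h1 : ∀ q : ℕ, (∫ ω, Y' ω ^ (2 * q) ∂P') / (2 * q).factorial =
        ∫ ω, Y' ω ^ (2 * q) / (2 * q).factorial ∂P' := fun q => (integral_div _ _).symm
    simp only [h1]
    rw [← integral_zero Ω' ℝ (μ := P')]
    refine tendsto_integral_of_dominated_convergence
      (fun ω => Real.exp (Y' ω) + Real.exp (- Y' ω))
      (fun q => ((hY' _).div_const _).aestronglyMeasurable) (hpos.add hneg)
      (fun q => ae_of_all _ fun ω => ?_) (ae_of_all _ fun ω => ?_)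
    · have h2 : Y' ω ^ (2 * q) = |Y' ω| ^ (2 * q) := by rw [pow_mul, pow_mul, sq_abs]
      rw [h2, Real.norm_of_nonneg (by positivity)]
      refine (Real.pow_div_factorial_le_exp _ (abs_nonneg _) _).trans ?_
      rcases abs_cases (Y' ω) with ⟨h3, -⟩ | ⟨h3, -⟩ <;> rw [h3]
      · exact le_add_of_nonneg_right (Real.exp_pos _).le
      · exact le_add_of_nonneg_left (Real.exp_pos _).le
    · exact (FloorSemiring.tendsto_pow_div_factorial_atTop (Y' ω)).comp
        (tendsto_id.const_mul_atTop' two_pos)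

end MethodOfMoments

/-! ### From mixed moments to joint convergence in distribution -/

section Convergence

variable {T : Type*}

theorem integral_sum_pow {Ω : Type*} {mΩ : MeasurableSpace Ω} {P : Measure Ω}
    [IsProbabilityMeasure P] {F : T → Ω → ℂ} (hF : ∀ t, HasMoments (F t) P) {J : Type*} [Fintype J]
    (c : J → ℂ) (u : J → T) (p : ℕ) :
    ∫ ω, (∑ j, c j * F (u j) ω) ^ p ∂P = ∑ κ : Fin p → J, (∏ i, c (κ i)) *
      ∫ ω, ((List.ofFn fun i => u (κ i)).map fun t => F t ω).prod ∂P := by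
  have h1 : ∀ ω, (∑ j, c j * F (u j) ω) ^ p = ∑ κ : Fin p → J,
      (∏ i, c (κ i)) * ∏ i, F (u (κ i)) ω := fun ω => by
    simp_rw [Fintype.sum_pow, Finset.prod_mul_distrib]
  simp_rw [h1]
  rw [integral_finsetSum]
  · refine Finset.sum_congr rfl fun κ _ => ?_
    rw [integral_const_mul]
    simp [List.map_ofFn, List.prod_ofFn]
  · exact fun κ _ =>
      ((HasMoments.finset_prod (x := fun i => F (u (κ i))) _ fun i _ => hF _).integrable).const_mul _

/-- A real inner product is half the sum of a complex product and its conjugate, and the conjugate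
of `F t` is the member `F (r t)`. So a real functional is a complex linear combination of members,
and moments without conjugates suffice. -/
theorem ofReal_sum_inner_eq {Ω : Type*} {mΩ : MeasurableSpace Ω} {P : Measure Ω} {F : T → Ω → ℂ}
    {r : T → T} (hr : ∀ t, ∀ᵐ ω ∂P, conj (F t ω) = F (r t) ω) {I : Finset T} (s : I → ℂ) :
    ∀ᵐ ω ∂P, ((∑ i : I, inner ℝ (F i ω) (s i) : ℝ) : ℂ) =
      ∑ j : I ⊕ I, Sum.elim (fun i => conj (s i) / 2) (fun i => s i / 2) j *
        F ((Sum.elim (fun i => i) (fun i => r i) : I ⊕ I → T) j) ω := by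
  filter_upwards [ae_all_iff.2 fun i : I => hr i] with ω hω
  simp only [Fintype.sum_sum_type, Sum.elim_inl, Sum.elim_inr, ← Finset.sum_add_distrib]
  push_cast
  refine Finset.sum_congr rfl fun i _ => ?_
  rw [← hω i, Complex.inner, Complex.re_eq_add_conj]
  simp only [map_mul, Complex.conj_conj]
  ring

theorem charFun_map_toLp {Ω : Type*} {mΩ : MeasurableSpace Ω} {P : Measure Ω} {I : Type*}
    [Fintype I] {F : I → Ω → ℂ} (hF : AEMeasurable (fun ω => WithLp.toLp 2 fun i => F i ω) P)
    (s : PiLp 2 fun _ : I => ℂ) :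
    charFun (P.map fun ω => WithLp.toLp 2 fun i => F i ω) s =
      ∫ ω, Complex.exp (((∑ i, inner ℝ (F i ω) (s i) : ℝ) : ℂ) * Complex.I) ∂P := by
  rw [charFun_apply, integral_map hF (by fun_prop)]
  simp [PiLp.inner_apply]

theorem tendstoInDistribution_of_tendsto_moments {Ω : ℕ → Type*}
    {mΩ : ∀ N, MeasurableSpace (Ω N)} {P : ∀ N, Measure (Ω N)} [∀ N, IsProbabilityMeasure (P N)]
    {Ω' : Type*} {mΩ' : MeasurableSpace Ω'} {P' : Measure Ω'} [IsProbabilityMeasure P']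
    {F : ∀ N, T → Ω N → ℂ} {Z : T → Ω' → ℂ} {r : T → T}
    (hF : ∀ N t, HasMoments (F N t) (P N))
    (hr : ∀ N t, ∀ᵐ ω ∂(P N), conj (F N t ω) = F N (r t) ω)
    (hZ : IsGaussianProcess Z P') (hr' : ∀ t, ∀ᵐ ω ∂P', conj (Z t ω) = Z (r t) ω)
    (h : ∀ L : List T, Tendsto (fun N => ∫ ω, (L.map fun t => F N t ω).prod ∂(P N)) atTop
      (𝓝 (∫ ω, (L.map fun t => Z t ω).prod ∂P'))) (I : Finset T) :
    TendstoInDistribution (fun N ω (t : I) => F N t ω) atTop (fun ω (t : I) => Z t ω) P P' := by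
  have hZm : ∀ t, HasMoments (Z t) P' := fun t =>
    hasMoments_of_hasGaussianLaw (hZ.hasGaussianLaw_eval t)
  have hm : ∀ N t, AEMeasurable (F N t) (P N) := fun N t =>
    (hF N t).integrable.aestronglyMeasurable.aemeasurable
  have hm' : ∀ t, AEMeasurable (Z t) P' := fun t =>
    (hZm t).integrable.aestronglyMeasurable.aemeasurable
  have hpi : ∀ N, AEMeasurable (fun ω => WithLp.toLp 2 fun t : I => F N t ω) (P N) := fun N =>
    (WithLp.measurable_toLp 2 _).comp_aemeasurable (aemeasurable_pi_lambda _ fun t => hm N t)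
  have hpi' : AEMeasurable (fun ω => WithLp.toLp 2 fun t : I => Z t ω) P' :=
    (WithLp.measurable_toLp 2 _).comp_aemeasurable (aemeasurable_pi_lambda _ fun t => hm' t)
  -- The Euclidean norm supplies the inner product for characteristic functions; the change back to
  -- the product space is continuous.
  suffices hL : TendstoInDistribution (fun N ω => WithLp.toLp 2 fun t : I => F N t ω) atTop
      (fun ω => WithLp.toLp 2 fun t : I => Z t ω) P P' from
    hL.continuous_comp (g := fun x : PiLp 2 fun _ : I => ℂ => x.ofLp) (PiLp.continuous_ofLp 2 _)
  refine ⟨hpi, hpi', ProbabilityMeasure.tendsto_iff_tendsto_charFun.2 fun s => ?_⟩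
  simp only [ProbabilityMeasure.coe_mk, charFun_map_toLp (hpi _), charFun_map_toLp hpi']
  have hmF : ∀ N, HasMoments (fun ω => ((∑ i : I, inner ℝ (F N i ω) (s i) : ℝ) : ℂ)) (P N) :=
    fun N => (HasMoments.finset_sum _ fun j _ => (hF N _).const_mul _).congr
      ((ofReal_sum_inner_eq (hr N) s).mono fun ω hω => hω.symm)
  have hmZ : HasMoments (fun ω => ((∑ i : I, inner ℝ (Z i ω) (s i) : ℝ) : ℂ)) P' :=
    (HasMoments.finset_sum _ fun j _ => (hZm _).const_mul _).congr
      ((ofReal_sum_inner_eq hr' s).mono fun ω hω => hω.symm)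
  have hG : HasGaussianLaw (fun ω => ∑ i : I, inner ℝ (Z i ω) (s i)) P' := by
    have h1 := (hasGaussianLaw_pi hZ fun i : I => (i : T)).map
      (∑ i : I, (innerSL ℝ (s i)).comp (ContinuousLinearMap.proj (R := ℝ) (φ := fun _ : I => ℂ) i))
    refine h1.congr (ae_of_all _ fun ω => ?_)
    simp [real_inner_comm, -Complex.inner]
  have hexp : ∀ a : ℝ, Integrable (fun ω => Real.exp (a * ∑ i : I, inner ℝ (Z i ω) (s i))) P' := by
    intro a
    have h1 := integrable_exp_mul_gaussianReal
      (μ := ∫ ω, ∑ i : I, inner ℝ (Z i ω) (s i) ∂P')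
      (v := Var[fun ω => ∑ i : I, inner ℝ (Z i ω) (s i); P'].toNNReal) a
    rw [← hG.map_eq_gaussianReal] at h1
    exact h1.comp_aemeasurable hG.aemeasurable
  refine tendsto_integral_exp_of_tendsto_moments (fun N => ?_) (fun N p => ?_) hG.aemeasurable
    (fun p => ?_) (by simpa using hexp 1) (by simpa using hexp (-1)) fun p => ?_
  · exact Complex.measurable_re.comp_aemeasurable
      (hmF N).integrable.aestronglyMeasurable.aemeasurable
  · have := ((hmF N).pow p).integrable.re
    simpa only [← Complex.ofReal_pow] using! this
  · have := (hmZ.pow p).integrable.re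
    simpa only [← Complex.ofReal_pow] using! this
  · have h1 : Tendsto (fun N => ∫ ω, ((∑ i : I, inner ℝ (F N i ω) (s i) : ℝ) : ℂ) ^ p ∂(P N)) atTop
        (𝓝 (∫ ω, ((∑ i : I, inner ℝ (Z i ω) (s i) : ℝ) : ℂ) ^ p ∂P')) := by
      rw [integral_congr_ae ((ofReal_sum_inner_eq hr' s).mono fun ω hω =>
        congrArg (fun z : ℂ => z ^ p) hω), integral_sum_pow hZm]
      refine Tendsto.congr (fun N => ?_) (tendsto_finsetSum _ fun κ _ => (h _).const_mul _)
      rw [integral_congr_ae ((ofReal_sum_inner_eq (hr N) s).mono fun ω hω =>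
        congrArg (fun z : ℂ => z ^ p) hω), integral_sum_pow (hF N)]
    simp only [← Complex.ofReal_pow, integral_complex_ofReal] at h1
    exact Complex.continuous_re.continuousAt.tendsto.comp h1

end Convergence

/-! ### The complex Gaussian limit family -/

section LimitFamily

/-- The complex combination of a real-valued process that intertwines an index involution `r` with
complex conjugation. -/
noncomputable def conjCombination {T Ω : Type*} (g : T → Ω → ℝ) (r : T → T) (t : T) (ω : Ω) : ℂ :=
  ⟨(g t ω + g (r t) ω) / 2, (g t ω - g (r t) ω) / 2⟩

theorem conj_conjCombination {T Ω : Type*} (g : T → Ω → ℝ) {r : T → T} (hr : ∀ t, r (r t) = t)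
    (t : T) (ω : Ω) : conj (conjCombination g r t ω) = conjCombination g r (r t) ω := by
  apply Complex.ext
  · simp only [conjCombination, Complex.conj_re, hr]
    ring
  · simp only [conjCombination, Complex.conj_im, hr]
    ring

theorem isGaussianProcess_conjCombination {T Ω : Type*} {mΩ : MeasurableSpace Ω} {P : Measure Ω}
    {g : T → Ω → ℝ} (hg : IsGaussianProcess g P) (r : T → T) :
    IsGaussianProcess (conjCombination g r) P := by
  classical
  refine hg.of_isGaussianProcess fun t => ?_
  let p : ({t, r t} : Finset T) := ⟨t, by simp⟩
  let q : ({t, r t} : Finset T) := ⟨r t, by simp⟩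
  let A : (({t, r t} : Finset T) → ℝ) →L[ℝ] ℝ := ContinuousLinearMap.proj p
  let B : (({t, r t} : Finset T) → ℝ) →L[ℝ] ℝ := ContinuousLinearMap.proj q
  refine ⟨{t, r t}, ((1 / 2 : ℝ) • (A + B)).smulRight (1 : ℂ) +
    ((1 / 2 : ℝ) • (A - B)).smulRight Complex.I, fun ω => ?_⟩
  apply Complex.ext
  · simp [conjCombination, A, B, p, q]
    ring
  · simp [conjCombination, A, B, p, q]
    ring

theorem integral_conjCombination {T Ω : Type*} {mΩ : MeasurableSpace Ω} {P : Measure Ω}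
    {g : T → Ω → ℝ} (hg : IsGaussianProcess g P) (h0 : ∀ t, ∫ ω, g t ω ∂P = 0) (r : T → T) (t : T) :
    ∫ ω, conjCombination g r t ω ∂P = 0 := by
  have hi : ∀ t, Integrable (g t) P := fun t => (hg.hasGaussianLaw_eval t).integrable
  have h1 : ∀ ω, conjCombination g r t ω =
      (((g t ω + g (r t) ω) / 2 : ℝ) : ℂ) + (((g t ω - g (r t) ω) / 2 : ℝ) : ℂ) * Complex.I :=
    fun ω => (Complex.mk_eq_add_mul_I _ _)
  simp_rw [h1]
  rw [integral_add, integral_mul_const, integral_complex_ofReal, integral_complex_ofReal,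
    integral_div, integral_div, integral_add (hi _) (hi _), integral_sub (hi _) (hi _)]
  · simp [h0]
  · exact (((hi _).add (hi _)).div_const _).ofReal
  · exact (((hi _).sub (hi _)).div_const _).ofReal.mul_const _

/-- In the expanded product the real part averages `K s t` with `K (r s) (r t)`, which agree. The
imaginary part is half the difference of `K s (r t)` and `K (r s) t`, which vanishes by the same
invariance. -/
theorem integral_conjCombination_mul {T Ω : Type*} {mΩ : MeasurableSpace Ω} {P : Measure Ω}
    {g : T → Ω → ℝ} (hg : IsGaussianProcess g P) {K : T → T → ℝ} {r : T → T}
    (hr : ∀ t, r (r t) = t) (hK : ∀ s t, K (r s) (r t) = K s t)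
    (hgK : ∀ s t, ∫ ω, g s ω * g t ω ∂P = K s (r t)) (s t : T) :
    ∫ ω, conjCombination g r s ω * conjCombination g r t ω ∂P = (K s t : ℂ) := by
  have hi : ∀ s t, Integrable (fun ω => g s ω * g t ω) P := fun s t =>
    (hg.hasGaussianLaw_eval s).memLp_two.integrable_mul (hg.hasGaussianLaw_eval t).memLp_two
  have h1 : ∀ ω, conjCombination g r s ω * conjCombination g r t ω =
      (((g s ω * g (r t) ω + g (r s) ω * g t ω) / 2 : ℝ) : ℂ) +
        (((g s ω * g t ω - g (r s) ω * g (r t) ω) / 2 : ℝ) : ℂ) * Complex.I := fun ω => by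
    simp only [conjCombination, Complex.mk_eq_add_mul_I]
    push_cast
    linear_combination (g s ω - g (r s) ω) * (g t ω - g (r t) ω) / 4 * Complex.I_sq
  simp_rw [h1]
  rw [integral_add, integral_mul_const, integral_complex_ofReal, integral_complex_ofReal,
    integral_div, integral_div, integral_add (hi _ _) (hi _ _), integral_sub (hi _ _) (hi _ _)]
  · have h2 : K (r s) t = K s (r t) := by rw [← hK, hr]
    simp [hgK, hr, hK, h2]
  · exact (((hi _ _).add (hi _ _)).div_const _).ofReal
  · exact (((hi _ _).sub (hi _ _)).div_const _).ofReal.mul_const _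

variable {H : Type*} [NormedAddCommGroup H] [InnerProductSpace ℝ H]

/-- Integration by parts in the first variable is the recursion that defines `wickSum`. -/
theorem integral_list_prod_eq_wickSum {T Ω : Type*} {mΩ : MeasurableSpace Ω} {P : Measure Ω}
    {Z : T → Ω → ℂ} (hZ : IsGaussianProcess Z P) (h0 : ∀ t, ∫ ω, Z t ω ∂P = 0) (u : T → List H)
    (hcov : ∀ s t, ∫ ω, Z s ω * Z t ω ∂P = (covList (u s) (u t) : ℂ)) (L : List T) :
    ∫ ω, (L.map fun t => Z t ω).prod ∂P = (wickSum (L.map u) : ℂ) := by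
  have := hZ.isProbabilityMeasure
  induction hn : L.length using Nat.strong_induction_on generalizing L with
  | _ n ih =>
    cases L with
    | nil => simp [wickSum_nil]
    | cons w L =>
      have h1 : ∀ ω (L : List T), (L.map fun t => Z t ω).prod = MvPolynomial.aeval (fun t => Z t ω)
          (L.map fun t => (MvPolynomial.X t : MvPolynomial T ℂ)).prod := by
        intro ω L
        simp [map_list_prod, Function.comp_def]
      simp only [List.map_cons, List.prod_cons]
      simp_rw [h1]
      rw [integral_X_mul_aeval hZ h0 w _ (hcov w), derivation_list_prod]
      simp only [map_sum, map_mul, MvPolynomial.mkDerivation_X, MvPolynomial.aeval_C, ← h1]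
      rw [integral_finsetSum]
      · simp_rw [integral_mul_const]
        rw [wickSum_cons]
        push_cast
        refine Fintype.sum_equiv (finCongr (List.length_map _).symm) _ _ fun k => ?_
        rw [ih _ (by
          rw [← hn, List.length_cons, List.length_eraseIdx_of_lt k.2]
          omega) _ rfl, mul_comm]
        simp [List.eraseIdx_map]
      · intro k _
        simp_rw [h1]
        exact (hasMoments_aeval (fun t => hasMoments_of_hasGaussianLaw (hZ.hasGaussianLaw_eval t))
          _).integrable.mul_const _

end LimitFamily

/-! ### Properties of the limit covariance and conclusion -/

section Main

/-- The word read backwards. -/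
def revWord {H : Type*} (w : Σ n : ℕ, Fin n → H) : Σ n : ℕ, Fin n → H :=
  ⟨w.1, fun i => w.2 i.rev⟩

theorem revWord_revWord {H : Type*} (w : Σ n : ℕ, Fin n → H) : revWord (revWord w) = w := by
  simp [revWord]

variable {H : Type*} [NormedAddCommGroup H] [InnerProductSpace ℝ H]

/-- The limit covariance of the fluctuations of two words. -/
noncomputable def wordCov (s t : Σ n : ℕ, Fin n → H) : ℝ :=
  covList (List.ofFn s.2) (List.ofFn t.2)

variable {Ω : ℕ → Type*} {mΩ : ∀ N, MeasurableSpace (Ω N)} {P : ∀ N, Measure (Ω N)}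
  [∀ N, IsProbabilityMeasure (P N)] {X : ∀ N, H → Ω N → Matrix (Fin N) (Fin N) ℂ}

theorem tendsto_integral_fluctuation_prod (hX : ∀ N, IsHermitianGaussianFamily (P N) (X N))
    (L : List (Σ n : ℕ, Fin n → H)) :
    Tendsto (fun N => ∫ ω, (L.map fun w => fluctuation (X N) w.2 ω).prod ∂(P N)) atTop
      (𝓝 (wickSum (L.map fun w => List.ofFn w.2) : ℂ)) := by
  simp_rw [fun N => integral_prod_fluctuation (hX N) L]
  exact tendsto_fluctMoment (fun N => (hX N).isWick) _

theorem tendsto_integral_fluctuation_mul (hX : ∀ N, IsHermitianGaussianFamily (P N) (X N))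
    (s t : Σ n : ℕ, Fin n → H) :
    Tendsto (fun N => ∫ ω, fluctuation (X N) s.2 ω * fluctuation (X N) t.2 ω ∂(P N)) atTop
      (𝓝 (wordCov s t : ℂ)) := by
  simpa [wickSum_cons, wickSum_nil, wordCov] using tendsto_integral_fluctuation_prod hX [s, t]

/-- The loop equation singles out the first word, which hides the symmetry; before the limit it is
plain, and limits are unique. -/
theorem wordCov_comm (hX : ∀ N, IsHermitianGaussianFamily (P N) (X N))
    (s t : Σ n : ℕ, Fin n → H) : wordCov s t = wordCov t s := by
  have h := tendsto_integral_fluctuation_mul hX t s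
  simp_rw [mul_comm] at h
  exact Complex.ofReal_injective
    (tendsto_nhds_unique (tendsto_integral_fluctuation_mul hX s t) h)

theorem wordCov_revWord (hX : ∀ N, IsHermitianGaussianFamily (P N) (X N))
    (s t : Σ n : ℕ, Fin n → H) : wordCov (revWord s) (revWord t) = wordCov s t := by
  have h := (Complex.continuous_conj.tendsto _).comp (tendsto_integral_fluctuation_mul hX s t)
  rw [Complex.conj_ofReal] at h
  refine Complex.ofReal_injective
    (tendsto_nhds_unique (tendsto_integral_fluctuation_mul hX _ _) (h.congr fun N => ?_))
  simp only [Function.comp_apply]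
  rw [← integral_conj]
  refine integral_congr_ae ?_
  filter_upwards [conj_fluctuation (hX N) s.2, conj_fluctuation (hX N) t.2] with ω h1 h2
  rw [map_mul, h1, h2]
  rfl

/-- Reversal is conjugation, so for each `N` the quadratic form is the expectation of the squared
modulus of a combination of fluctuations; positivity passes to the limit. -/
theorem wordCov_nonneg (hX : ∀ N, IsHermitianGaussianFamily (P N) (X N))
    (c : (Σ n : ℕ, Fin n → H) →₀ ℝ) :
    0 ≤ c.sum fun s a => c.sum fun t b => a * b * wordCov s (revWord t) := by
  have h : Tendsto (fun N => ∑ s ∈ c.support, ∑ t ∈ c.support, ((c s : ℂ) * c t) *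
      ∫ ω, fluctuation (X N) s.2 ω * fluctuation (X N) (revWord t).2 ω ∂(P N)) atTop
      (𝓝 (∑ s ∈ c.support, ∑ t ∈ c.support, ((c s : ℂ) * c t) * (wordCov s (revWord t) : ℂ))) :=
    tendsto_finsetSum _ fun s _ => tendsto_finsetSum _ fun t _ =>
      (tendsto_integral_fluctuation_mul hX s (revWord t)).const_mul _
  have h2 := (Complex.continuous_re.tendsto _).comp h
  have h3 : (∑ s ∈ c.support, ∑ t ∈ c.support, ((c s : ℂ) * c t) *
      (wordCov s (revWord t) : ℂ)).re =
      c.sum fun s a => c.sum fun t b => a * b * wordCov s (revWord t) := by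
    simp only [Finsupp.sum, ← Complex.ofReal_mul, ← Complex.ofReal_sum, Complex.ofReal_re]
  rw [h3] at h2
  refine ge_of_tendsto' h2 fun N => ?_
  have hi : ∀ s t : Σ n : ℕ, Fin n → H, Integrable (fun ω => ((c s : ℂ) * c t) *
      (fluctuation (X N) s.2 ω * fluctuation (X N) (revWord t).2 ω)) (P N) := fun s t =>
    (((hasMoments_fluctuation (hX N) s.2).mul
      (hasMoments_fluctuation (hX N) (revWord t).2)).integrable).const_mul _
  have h4 : ∑ s ∈ c.support, ∑ t ∈ c.support, ((c s : ℂ) * c t) *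
      ∫ ω, fluctuation (X N) s.2 ω * fluctuation (X N) (revWord t).2 ω ∂(P N) =
      ∫ ω, ((Complex.normSq (∑ s ∈ c.support, (c s : ℂ) * fluctuation (X N) s.2 ω) : ℝ) : ℂ)
        ∂(P N) := by
    simp_rw [← integral_const_mul]
    simp_rw [fun s => (integral_finsetSum c.support fun t _ => hi s t).symm]
    rw [← integral_finsetSum c.support fun s _ => integrable_finsetSum _ fun t _ => hi s t]
    refine integral_congr_ae ?_
    filter_upwards [(ae_ball_iff c.support.countable_toSet).2 fun (t : Σ n : ℕ, Fin n → H) _ =>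
      conj_fluctuation (hX N) t.2] with ω hω
    rw [← Complex.mul_conj, map_sum, Finset.sum_mul_sum]
    refine Finset.sum_congr rfl fun s _ => Finset.sum_congr rfl fun t ht => ?_
    rw [map_mul, Complex.conj_ofReal, hω t ht]
    simp only [revWord]
    ring
  simp only [Function.comp_apply]
  rw [h4, integral_complex_ofReal, Complex.ofReal_re]
  exact integral_nonneg fun ω => Complex.normSq_nonneg _

end Main

end SecondOrder

theorem mainTheorem6 {H : Type u} [NormedAddCommGroup H] [InnerProductSpace ℝ H] [CompleteSpace H]
    (Ω : ℕ → Type v) [∀ N, MeasurableSpace (Ω N)]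
    (P : ∀ N, Measure (Ω N)) [∀ N, IsProbabilityMeasure (P N)]
    (X : ∀ N, H → Ω N → Matrix (Fin N) (Fin N) ℂ)
    (hX : ∀ N, SecondOrder.IsHermitianGaussianFamily (P N) (X N)) :
    ∃ (Ω' : Type u) (_ : MeasurableSpace Ω') (P' : Measure Ω') (_ : IsProbabilityMeasure P')
      (F : (Σ n : ℕ, Fin n → H) → Ω' → ℂ),
      IsGaussianProcess F P' ∧
      (∀ w, ∫ ω, F w ω ∂P' = 0) ∧
      (∀ (n m : ℕ) (f : Fin n → H) (g : Fin m → H),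
        ∫ ω, F ⟨n, f⟩ ω * F ⟨m, g⟩ ω ∂P' = ((SecondOrder.limitCov f g : ℝ) : ℂ)) ∧
      ∀ I : Finset (Σ n : ℕ, Fin n → H),
        TendstoInDistribution
          (fun (N : ℕ) (ω : Ω N) (w : I) => SecondOrder.fluctuation (X N) w.1.2 ω)
          atTop (fun (ω : Ω') (w : I) => F w.1 ω) P P' := by
  have hr := SecondOrder.revWord_revWord (H := H)
  have hK := SecondOrder.wordCov_revWord hX
  -- The reversal in the second argument turns the pseudo-covariance into the Hermitian covariance,
  -- the one that is positive semidefinite.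
  obtain ⟨Ω', _, P', _, g, hg, h0, hgK⟩ := SecondOrder.exists_gaussianProcess
    (K := fun s t => SecondOrder.wordCov s (SecondOrder.revWord t)) (fun s t => by
      rw [← hK, hr, SecondOrder.wordCov_comm hX]) (SecondOrder.wordCov_nonneg hX)
  have hZ := SecondOrder.isGaussianProcess_conjCombination hg SecondOrder.revWord
  have hZ0 := SecondOrder.integral_conjCombination hg h0 SecondOrder.revWord
  have hZK := SecondOrder.integral_conjCombination_mul hg hr hK hgK
  refine ⟨Ω', inferInstance, P', inferInstance, SecondOrder.conjCombination g SecondOrder.revWord, hZ, hZ0,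
    fun n m f h => ?_, fun I => ?_⟩
  · rw [hZK, SecondOrder.limitCov_eq_covList (fun N => (hX N).isWick)]
    rfl
  · have hm : ∀ N (w : Σ n : ℕ, Fin n → H),
        SecondOrder.HasMoments (SecondOrder.fluctuation (X N) w.2) (P N) :=
      fun N w => SecondOrder.hasMoments_fluctuation (hX N) w.2
    have hconj : ∀ N (w : Σ n : ℕ, Fin n → H), ∀ᵐ ω ∂(P N),
        conj (SecondOrder.fluctuation (X N) w.2 ω) =
          SecondOrder.fluctuation (X N) (SecondOrder.revWord w).2 ω :=
      fun N w => SecondOrder.conj_fluctuation (hX N) w.2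
    refine SecondOrder.tendstoInDistribution_of_tendsto_moments
      (F := fun N (w : Σ n : ℕ, Fin n → H) => SecondOrder.fluctuation (X N) w.2) hm hconj hZ
      (fun w => ae_of_all _ fun ω => SecondOrder.conj_conjCombination g hr w ω) (fun L => ?_) I
    rw [SecondOrder.integral_list_prod_eq_wickSum hZ hZ0 (fun w => List.ofFn w.2) hZK]
    exact SecondOrder.tendsto_integral_fluctuation_prod hX L
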